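/- Let $\mathbf k$ be a field, $n\ge 1$, and let $q\in\mathbf k^\times$ satisfy $q^3\neq 1$ and $q^4\neq 1$. Let $p_{ij}\in\mathbf k^\times$ $(1\le i,j\le n)$ satisfy $p_{nn}=q$, $p_{ii}=q^2$ and $p_{i\,i+1}p_{i+1\,i}=q^{-2}$ for $1\le i<n$, and $p_{ij}p_{ji}=1$ for $j>i+1$. Let $G$ be the group generated by the linear transformations $g_j:x_i\mapsto p_{ij}x_i$ of the space with basis $x_1,\dots,x_n$, and let $\chi^i:G\to\mathbf k^\times$ be the character with $\chi^i(g_j)=p_{ij}$. For words $u,v$ in the $x_i$ let $g_v\in G$ and $\chi^u$ be obtained by replacing each $x_i$ with $g_i$, respectively $\chi^i$; put $p(u,v)=\chi^u(g_v)$ and $[u,v]=uv-p(u,v)\,vu$, extended bilinearly to linear combinations of words homogeneous in each $x_i$. The multiparameter quantum Borel algebra $U_q^+(\mathfrak{so}_{2n+1})$ is the $\mathbf k$-algebra generated by $G$ and $x_1,\dots,x_n$ subject to the relations of $G$, $x_ig=\chi^i(g)\,gx_i$ $(g\in G)$, and $$[x_i,[x_i,x_{i+1}]]=0\ (1\le i<n),\quad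 [x_i,x_j]=0\ (j>i+1),\quad [[x_i,x_{i+1}],x_{i+1}]=0\ (1\le i<n-1),$$ $$[[[x_{n-1},x_n],x_n],x_n]=0\ (n\ge 2).$$ It is a bialgebra whose coproduct is the algebra homomorphism with $\Delta(x_i)=x_i\otimes 1+g_i\otimes x_i$ and $\Delta(g)=g\otimes g$ for $g\in G$. For $n<i\le 2n$ put $x_i=x_{2n-i+1}$, $g_i=g_{2n-i+1}$; let $u(k,m)=x_kx_{k+1}\cdots x_m$ and $\psi(k)=2n-k+1$. For $1\le k\le m\le 2n$ define $$u[k,m]=\begin{cases}[[\ldots[x_k,x_{k+1}],\ldots,x_{m-1}],x_m], & m<\psi(k),\\ [x_k,[x_{k+1},[\ldots,[x_{m-1},x_m]\ldots]]], & m>\psi(k),\\ -p(u(n+1,m),u(k,n))^{-1}\,[u[n+1,m],u[k,n]], & m=\psi(k).\end{cases}$$ Then for all $1\le k\le m\le 2n$, in $U_q^+(\mathfrak{so}_{2n+1})\otimes U_q^+(\mathfrak{so}_{2n+1})$, $$\Delta(u[k,m])=u[k,m]\otimes 1+g_kg_{k+1}\cdots g_m\otimes u[k,m]+\sum_{i=k}^{m-1}\tau_i(1-q^{-2})\,g_kg_{k+1}\cdots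 g_i\,u[i+1,m]\otimes u[k,i],$$ where $\tau_n=q$ and $\tau_i=1$ for $i\neq n$. -/

import Mathlib

open scoped TensorProduct

/-- The parameters of the multiparameter quantization of type `B_n`: a nonzero scalar `q` and
nonzero scalars `p i j` with `p_{nn} = q`, `p_{ii} = q²` and `p_{i,i+1} p_{i+1,i} = q⁻²` for `i < n`,
`p_{ij} p_{ji} = 1` for `j > i + 1`.  The indices `1, …, n` are the elements `0, …, n - 1` of
`Fin n`. -/
structure BParam (F : Type*) [Field F] (n : ℕ) where
  q : Fˣ
  p : Fin n → Fin n → Fˣ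
  p_last : ∀ i : Fin n, (i : ℕ) + 1 = n → p i i = q
  p_diag : ∀ i : Fin n, (i : ℕ) + 1 < n → p i i = q ^ 2
  p_adj : ∀ i j : Fin n, (i : ℕ) + 1 = j → p i j * p j i = (q ^ 2)⁻¹
  p_far : ∀ i j : Fin n, (i : ℕ) + 1 < j → p i j * p j i = 1

namespace BParam

variable {F : Type*} [Field F] {n : ℕ}

/-- The group `G` generated by the linear transformations `g_j : x_i ↦ p_{ij} x_i` of the span of
`x_1, …, x_n`; a diagonal invertible transformation is given by its family of eigenvalues. -/
def G (P : BParam F n) : Subgroup (Fin n → Fˣ) :=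
  Subgroup.closure (Set.range fun j : Fin n => fun i : Fin n => P.p i j)

/-- The generator `g_j` of `G`. -/
def g (P : BParam F n) (j : Fin n) : P.G :=
  ⟨fun i => P.p i j, Subgroup.subset_closure ⟨j, rfl⟩⟩

/-- The character `χ^i` of `G`; it sends `g_j` to `p_{ij}`. -/
def χ (P : BParam F n) (i : Fin n) : P.G →* Fˣ :=
  (Pi.evalMonoidHom (fun _ : Fin n => Fˣ) i).comp P.G.subtype

/-- The element `g_w` of `G` obtained from a (nonassociative) word `w` by `x_i ↦ g_i`. -/
def gr (P : BParam F n) : FreeMagma (Fin n) → P.G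
  | .of i => P.g i
  | .mul u v => gr P u * gr P v

/-- The character `χ^w` of `G` obtained from a (nonassociative) word `w` by `x_i ↦ χ^i`. -/
def chr (P : BParam F n) : FreeMagma (Fin n) → (P.G →* Fˣ)
  | .of i => P.χ i
  | .mul u v => chr P u * chr P v

/-- The value of a nonassociative word at `a_1, …, a_n`, where the brackets mean
`[u, v] = u v - χ^u(g_v) v u`. -/
def bracket (P : BParam F n) {A : Type*} [Ring A] [Algebra F A] (a : Fin n → A) :
    FreeMagma (Fin n) → A
  | .of i => a i
  | .mul u v => bracket P a u * bracket P a v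
      - (P.chr u (P.gr v) : F) • (bracket P a v * bracket P a u)

/-- The nonassociative words whose values are the left hand sides of the defining relations:
`[x_i,[x_i,x_{i+1}]]` for `i < n`, `[x_i,x_j]` for `j > i + 1`, `[[x_i,x_{i+1}],x_{i+1}]` for
`i < n - 1`, and `[[[x_{n-1},x_n],x_n],x_n]`. -/
inductive Serre (n : ℕ) : FreeMagma (Fin n) → Prop
  | left (i j : Fin n) : (i : ℕ) + 1 = j →
      Serre n (.of i * (.of i * .of j))
  | far (i j : Fin n) : (i : ℕ) + 1 < j →
      Serre n (.of i * .of j)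
  | right (i j : Fin n) : (i : ℕ) + 1 = j → (j : ℕ) + 1 < n →
      Serre n ((.of i * .of j) * .of j)
  | last (i j : Fin n) : (i : ℕ) + 1 = j → (j : ℕ) + 1 = n →
      Serre n (((.of i * .of j) * .of j) * .of j)

/-- The defining relations of `U_q^+(so_{2n+1})` on the generators `x_i` and `g ∈ G`: those of the
skew group algebra `G⟨X⟩` (the multiplication table of `G` and `x_i g = χ^i(g) g x_i`), and the
Serre relations. -/
inductive Rel (P : BParam F n) :
    FreeAlgebra F (Fin n ⊕ P.G) → FreeAlgebra F (Fin n ⊕ P.G) → Prop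
  | one : Rel P (FreeAlgebra.ι F (.inr 1)) 1
  | mul (g h : P.G) : Rel P (FreeAlgebra.ι F (.inr (g * h)))
      (FreeAlgebra.ι F (.inr g) * FreeAlgebra.ι F (.inr h))
  | comm (i : Fin n) (g : P.G) : Rel P
      (FreeAlgebra.ι F (.inl i) * FreeAlgebra.ι F (.inr g))
      ((P.χ i g : F) • (FreeAlgebra.ι F (.inr g) * FreeAlgebra.ι F (.inl i)))
  | serre (w : FreeMagma (Fin n)) : Serre n w →
      Rel P (P.bracket (fun i => FreeAlgebra.ι F (.inl i)) w) 0

/-- The quantum Borel algebra `U_q^+(so_{2n+1})`. -/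
def U (P : BParam F n) : Type _ := RingQuot (Rel P)

noncomputable instance (P : BParam F n) : Ring P.U := inferInstanceAs (Ring (RingQuot (Rel P)))

noncomputable instance (P : BParam F n) : Algebra F P.U :=
  inferInstanceAs (Algebra F (RingQuot (Rel P)))

/-- The generator `x_i` of `U_q^+(so_{2n+1})`. -/
noncomputable def X (P : BParam F n) (i : Fin n) : P.U :=
  RingQuot.mkAlgHom F (Rel P) (FreeAlgebra.ι F (.inl i))

/-- The image of `g ∈ G` in `U_q^+(so_{2n+1})`. -/
noncomputable def grp (P : BParam F n) (g : P.G) : P.U :=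
  RingQuot.mkAlgHom F (Rel P) (FreeAlgebra.ι F (.inr g))

theorem map_bracket (P : BParam F n) {A B : Type*} [Ring A] [Algebra F A] [Ring B] [Algebra F B]
    (f : A →ₐ[F] B) (a : Fin n → A) (w : FreeMagma (Fin n)) :
    f (P.bracket a w) = P.bracket (fun i => f (a i)) w := by
  induction w using FreeMagma.rec with
  | of i => rfl
  | mul u v hu hv => simp [bracket, hu, hv]

theorem grp_one (P : BParam F n) : P.grp 1 = 1 := by
  have := RingQuot.mkAlgHom_rel F (Rel.one (P := P))
  exact this.trans (map_one _)

theorem grp_mul (P : BParam F n) (a b : P.G) : P.grp (a * b) = P.grp a * P.grp b := by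
  have := RingQuot.mkAlgHom_rel F (Rel.mul (P := P) a b)
  rw [map_mul] at this
  exact this

theorem X_mul_grp (P : BParam F n) (i : Fin n) (a : P.G) :
    P.X i * P.grp a = (P.χ i a : F) • (P.grp a * P.X i) := by
  have := RingQuot.mkAlgHom_rel F (Rel.comm (P := P) i a)
  rw [map_mul, map_smul, map_mul] at this
  exact this

theorem bracket_X (P : BParam F n) {w : FreeMagma (Fin n)} (hw : Serre n w) :
    P.bracket P.X w = 0 := by
  have := RingQuot.mkAlgHom_rel F (Rel.serre (P := P) w hw)
  rw [map_bracket, map_zero] at this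
  exact this

/-- The universal property of `U_q^+(so_{2n+1})`. -/
noncomputable def lift (P : BParam F n) {A : Type*} [Ring A] [Algebra F A]
    (a : Fin n → A) (γ : P.G →* A) (hcomm : ∀ i g, a i * γ g = (P.χ i g : F) • (γ g * a i))
    (hs : ∀ w, Serre n w → P.bracket a w = 0) : P.U →ₐ[F] A :=
  RingQuot.liftAlgHom F ⟨FreeAlgebra.lift F (Sum.elim a γ), by
    intro x y h
    induction h with
    | one => simp
    | mul g h => simp
    | comm i g => simpa using hcomm i g
    | serre w hw =>
      rw [map_bracket, map_zero]
      simpa using hs w hw⟩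

theorem lift_X (P : BParam F n) {A : Type*} [Ring A] [Algebra F A]
    (a : Fin n → A) (γ : P.G →* A) (hcomm hs) (i : Fin n) :
    P.lift a γ hcomm hs (P.X i) = a i := by
  simp only [lift, X]
  erw [RingQuot.liftAlgHom_mkAlgHom_apply]
  simp

theorem lift_grp (P : BParam F n) {A : Type*} [Ring A] [Algebra F A]
    (a : Fin n → A) (γ : P.G →* A) (hcomm hs) (g : P.G) :
    P.lift a γ hcomm hs (P.grp g) = γ g := by
  simp only [lift, grp]
  erw [RingQuot.liftAlgHom_mkAlgHom_apply]
  simp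

theorem algHom_ext (P : BParam F n) {A : Type*} [Ring A] [Algebra F A]
    {φ ψ : P.U →ₐ[F] A} (hX : ∀ i, φ (P.X i) = ψ (P.X i))
    (hg : ∀ g, φ (P.grp g) = ψ (P.grp g)) : φ = ψ := by
  refine RingQuot.ringQuot_ext' F φ ψ ?_
  refine FreeAlgebra.hom_ext ?_
  funext s
  rcases s with i | g
  · exact hX i
  · exact hg g

theorem χ_g (P : BParam F n) (i j : Fin n) : P.χ i (P.g j) = P.p i j := rfl


section Sum

variable {A : Type*} [Ring A] [Algebra F A]

theorem aux_far {x y u v : A} {c d : F} (hcd : c * d = 1)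
    (hxv : x * v = c • (v * x)) (hyu : y * u = d • (u * y))
    (h1 : x * y - c • (y * x) = 0) (h2 : u * v - c • (v * u) = 0) :
    (x + u) * (y + v) - c • ((y + v) * (x + u)) = 0 := by
  have e : (x + u) * (y + v) - c • ((y + v) * (x + u)) =
      (x * y - c • (y * x)) + (u * v - c • (v * u)) + (x * v - c • (v * x))
        + (u * y - c • (y * u)) := by
    simp only [mul_add, add_mul, smul_add]; abel
  rw [e, h1, h2, hxv, hyu, smul_smul, hcd]; simp


theorem assoc_rule {x v : A} {c : F} (h : x * v = c • (v * x)) (z : A) :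
    x * (v * z) = c • (v * (x * z)) := by
  rw [← mul_assoc, h, smul_mul_assoc, mul_assoc]

theorem aux_left {x y u v : A} {s c d : F} (hc : c ≠ 0) (hs : s ≠ 0) (hcd : c * d = s⁻¹)
    (hxu : x * u = s • (u * x))
    (hxv : x * v = c • (v * x)) (hyu : y * u = d • (u * y))
    (h1 : x * (x * y - c • (y * x)) - (s * c) • ((x * y - c • (y * x)) * x) = 0)
    (h2 : u * (u * v - c • (v * u)) - (s * c) • ((u * v - c • (v * u)) * u) = 0) :
    (x + u) * ((x + u) * (y + v) - c • ((y + v) * (x + u)))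
      - (s * c) • (((x + u) * (y + v) - c • ((y + v) * (x + u))) * (x + u)) = 0 := by
  have hd : d = s⁻¹ * c⁻¹ := by field_simp at hcd ⊢; linear_combination hcd
  subst hd
  have axu := assoc_rule hxu
  have axv := assoc_rule hxv
  have ayu := assoc_rule hyu
  simp only [mul_add, add_mul, mul_sub, sub_mul, smul_add, smul_sub, mul_assoc, smul_mul_assoc,
    mul_smul_comm, smul_smul, hxu, hxv, hyu, axu, axv, ayu] at h1 h2 ⊢
  rw [← add_zero (0 : A)]
  nth_rewrite 1 [← h1]
  rw [← h2]
  match_scalars <;> field_simp <;> ring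

theorem aux_right {x y u v : A} {s c d : F} (hc : c ≠ 0) (hs : s ≠ 0)
    (hcd : c * d = s⁻¹) (hyv : y * v = s • (v * y))
    (hxv : x * v = c • (v * x)) (hyu : y * u = d • (u * y))
    (h1 : (x * y - c • (y * x)) * y - (c * s) • (y * (x * y - c • (y * x))) = 0)
    (h2 : (u * v - c • (v * u)) * v - (c * s) • (v * (u * v - c • (v * u))) = 0) :
    ((x + u) * (y + v) - c • ((y + v) * (x + u))) * (y + v)
      - (c * s) • ((y + v) * ((x + u) * (y + v) - c • ((y + v) * (x + u)))) = 0 := by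
  have hd : d = s⁻¹ * c⁻¹ := by field_simp at hcd ⊢; linear_combination hcd
  subst hd
  have ayv := assoc_rule hyv
  have axv := assoc_rule hxv
  have ayu := assoc_rule hyu
  simp only [mul_add, add_mul, mul_sub, sub_mul, smul_add, smul_sub, mul_assoc, smul_mul_assoc,
    mul_smul_comm, smul_smul, hyv, hxv, hyu, ayv, axv, ayu] at h1 h2 ⊢
  rw [← add_zero (0 : A)]
  nth_rewrite 1 [← h1]
  rw [← h2]
  match_scalars <;> field_simp <;> ring

theorem aux_last {x y u v : A} {s c d : F} (hc : c ≠ 0) (hs : s ≠ 0)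
    (hcd : c * d = (s ^ 2)⁻¹) (hyv : y * v = s • (v * y))
    (hxv : x * v = c • (v * x)) (hyu : y * u = d • (u * y))
    (h1 : ((x * y - c • (y * x)) * y - (c * s) • (y * (x * y - c • (y * x)))) * y
      - (c * s * s) • (y * ((x * y - c • (y * x)) * y
        - (c * s) • (y * (x * y - c • (y * x))))) = 0)
    (h2 : ((u * v - c • (v * u)) * v - (c * s) • (v * (u * v - c • (v * u)))) * v
      - (c * s * s) • (v * ((u * v - c • (v * u)) * v
        - (c * s) • (v * (u * v - c • (v * u))))) = 0) :
    (((x + u) * (y + v) - c • ((y + v) * (x + u))) * (y + v)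
      - (c * s) • ((y + v) * ((x + u) * (y + v) - c • ((y + v) * (x + u))))) * (y + v)
      - (c * s * s) • ((y + v) * (((x + u) * (y + v) - c • ((y + v) * (x + u))) * (y + v)
      - (c * s) • ((y + v) * ((x + u) * (y + v) - c • ((y + v) * (x + u)))))) = 0 := by
  have hd : d = (s ^ 2)⁻¹ * c⁻¹ := by field_simp at hcd ⊢; linear_combination hcd
  subst hd
  have ayv := assoc_rule hyv
  have axv := assoc_rule hxv
  have ayu := assoc_rule hyu
  simp only [mul_add, add_mul, mul_sub, sub_mul, smul_add, smul_sub, mul_assoc, smul_mul_assoc,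
    mul_smul_comm, smul_smul, hyv, hxv, hyu, ayv, axv, ayu] at h1 h2 ⊢
  rw [← add_zero (0 : A)]
  nth_rewrite 1 [← h1]
  rw [← h2]
  match_scalars <;> field_simp <;> ring

/-- If `a` and `b` satisfy the Serre relations and `a i * b j = p i j • (b j * a i)`, then
`a + b` satisfies the Serre relations. -/
theorem bracket_add_eq_zero (P : BParam F n) {a b : Fin n → A}
    (hab : ∀ i j, a i * b j = (P.p i j : F) • (b j * a i))
    (ha : ∀ w, Serre n w → P.bracket a w = 0) (hb : ∀ w, Serre n w → P.bracket b w = 0)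
    (w : FreeMagma (Fin n)) (hw : Serre n w) : P.bracket (fun i => a i + b i) w = 0 := by
  have h1 := ha w hw
  have h2 := hb w hw
  have chr_of (i) : P.chr (.of i) = P.χ i := rfl
  have gr_of (i) : P.gr (.of i) = P.g i := rfl
  have chr_mul (u v) : P.chr (u * v) = P.chr u * P.chr v := rfl
  have gr_mul (u v) : P.gr (u * v) = P.gr u * P.gr v := rfl
  have br_of (c : Fin n → A) (i) : P.bracket c (.of i) = c i := rfl
  have br_mul (c : Fin n → A) (u v) : P.bracket c (u * v) = P.bracket c u * P.bracket c v
      - (P.chr u (P.gr v) : F) • (P.bracket c v * P.bracket c u) := rfl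
  cases hw with
  | left i j hij =>
    have hq : P.p i i = P.q ^ 2 := P.p_diag i (by omega)
    have hcd : (P.p i j : F) * P.p j i = (P.p i i : F)⁻¹ := by
      rw [hq]; exact_mod_cast congrArg Units.val (P.p_adj i j hij)
    simp only [br_of, br_mul, chr_of, gr_of, chr_mul, gr_mul, map_mul, MonoidHom.mul_apply, χ_g,
      Units.val_mul] at h1 h2 ⊢
    exact aux_left (Units.ne_zero _) (Units.ne_zero _) hcd (hab i i) (hab i j) (hab j i) h1 h2
  | far i j hij =>
    have hcd : (P.p i j : F) * P.p j i = 1 := by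
      rw [← Units.val_mul, P.p_far i j hij, Units.val_one]
    simp only [br_of, br_mul, chr_of, gr_of, χ_g] at h1 h2 ⊢
    exact aux_far hcd (hab i j) (hab j i) h1 h2
  | right i j hij hj =>
    have hq : P.p j j = P.q ^ 2 := P.p_diag j hj
    have hcd : (P.p i j : F) * P.p j i = (P.p j j : F)⁻¹ := by
      rw [hq]; exact_mod_cast congrArg Units.val (P.p_adj i j hij)
    simp only [br_of, br_mul, chr_of, gr_of, chr_mul, gr_mul, map_mul, MonoidHom.mul_apply, χ_g,
      Units.val_mul] at h1 h2 ⊢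
    exact aux_right (Units.ne_zero _) (Units.ne_zero _) hcd (hab j j) (hab i j) (hab j i) h1 h2
  | last i j hij hj =>
    have hq : P.p j j = P.q := P.p_last j hj
    have hcd : (P.p i j : F) * P.p j i = ((P.p j j : F) ^ 2)⁻¹ := by
      rw [hq]; exact_mod_cast congrArg Units.val (P.p_adj i j hij)
    simp only [br_of, br_mul, chr_of, gr_of, chr_mul, gr_mul, map_mul, MonoidHom.mul_apply, χ_g,
      Units.val_mul] at h1 h2 ⊢
    exact aux_last (Units.ne_zero _) (Units.ne_zero _) hcd (hab j j) (hab i j) (hab j i) h1 h2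

end Sum

theorem bracket_grp_tmul (P : BParam F n) (w : FreeMagma (Fin n)) :
    P.bracket (fun i => P.grp (P.g i) ⊗ₜ[F] P.X i) w
      = P.grp (P.gr w) ⊗ₜ[F] P.bracket P.X w := by
  induction w using FreeMagma.rec with
  | of i => rfl
  | mul u v hu hv =>
    simp only [bracket, hu, hv, gr, Algebra.TensorProduct.tmul_mul_tmul, ← grp_mul,
      TensorProduct.tmul_sub, TensorProduct.tmul_smul, mul_comm (P.gr v)]

/-- The coproduct of `U_q^+(so_{2n+1})`: the algebra homomorphism with
`Δ(x_i) = x_i ⊗ 1 + g_i ⊗ x_i` and `Δ(g) = g ⊗ g`. -/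
noncomputable def comulHom (P : BParam F n) : P.U →ₐ[F] P.U ⊗[F] P.U :=
  P.lift (fun i => P.X i ⊗ₜ[F] (1 : P.U) + P.grp (P.g i) ⊗ₜ[F] P.X i)
    { toFun := fun g => P.grp g ⊗ₜ[F] P.grp g
      map_one' := by rw [grp_one]; rfl
      map_mul' := fun a b => by rw [grp_mul, Algebra.TensorProduct.tmul_mul_tmul] }
    (fun i g => by
      simp only [MonoidHom.coe_mk, OneHom.coe_mk, add_mul, mul_add,
        Algebra.TensorProduct.tmul_mul_tmul, X_mul_grp, one_mul, mul_one, ← grp_mul, smul_add,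
        TensorProduct.tmul_smul, TensorProduct.smul_tmul', mul_comm (P.g i)])
    (P.bracket_add_eq_zero
      (fun i j => by
        simp only [Algebra.TensorProduct.tmul_mul_tmul, X_mul_grp, one_mul, mul_one, χ_g,
          TensorProduct.smul_tmul'])
      (fun w hw => by
        have h := P.map_bracket (Algebra.TensorProduct.includeLeft (R := F) (S := F)
          (A := P.U) (B := P.U)) P.X w
        rw [bracket_X P hw, map_zero] at h
        exact h.symm)
      (fun w hw => by
        rw [bracket_grp_tmul, bracket_X P hw, TensorProduct.tmul_zero]))

/-- The counit of `U_q^+(so_{2n+1})`: `ε(x_i) = 0` and `ε(g) = 1`. -/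
noncomputable def counitHom (P : BParam F n) : P.U →ₐ[F] F :=
  P.lift (fun _ => 0) 1 (fun i g => by simp) (fun w hw => by
    cases hw <;> (change _ * _ - _ • (_ * _) = _; simp [bracket]))

theorem comulHom_X (P : BParam F n) (i : Fin n) :
    P.comulHom (P.X i) = P.X i ⊗ₜ[F] (1 : P.U) + P.grp (P.g i) ⊗ₜ[F] P.X i :=
  P.lift_X _ _ _ _ i

theorem comulHom_grp (P : BParam F n) (g : P.G) :
    P.comulHom (P.grp g) = P.grp g ⊗ₜ[F] P.grp g :=
  P.lift_grp _ _ _ _ g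

theorem counitHom_X (P : BParam F n) (i : Fin n) : P.counitHom (P.X i) = 0 :=
  P.lift_X _ _ _ _ i

theorem counitHom_grp (P : BParam F n) (g : P.G) : P.counitHom (P.grp g) = 1 :=
  P.lift_grp _ _ _ _ g

noncomputable instance (P : BParam F n) : Bialgebra F P.U :=
  Bialgebra.ofAlgHom P.comulHom P.counitHom
    (P.algHom_ext
      (fun i => by
        simp [comulHom_X, comulHom_grp, TensorProduct.add_tmul, TensorProduct.tmul_add,
          Algebra.TensorProduct.one_def, add_assoc])
      (fun g => by simp [comulHom_grp]))
    (P.algHom_ext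
      (fun i => by simp [comulHom_X, counitHom_X, counitHom_grp])
      (fun g => by simp [comulHom_grp, counitHom_grp]))
    (P.algHom_ext
      (fun i => by simp [comulHom_X, counitHom_X, counitHom_grp])
      (fun g => by simp [comulHom_grp, counitHom_grp]))

section Elements

variable [NeZero n]

/-- For `1 ≤ i ≤ 2n`, the index in `Fin n` of the letter `x_i`, where `x_i = x_{2n-i+1}` for
`n < i ≤ 2n`. -/
def letter (n : ℕ) [NeZero n] (i : ℕ) : Fin n :=
  Fin.ofNat n (if i ≤ n then i - 1 else 2 * n - i)

/-- The nonassociative word `[[…[x_k, x_{k+1}], …], x_{k+r}]`. -/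
def leftWord (n : ℕ) [NeZero n] (k : ℕ) : ℕ → FreeMagma (Fin n)
  | 0 => .of (letter n k)
  | r + 1 => leftWord n k r * .of (letter n (k + r + 1))

/-- The nonassociative word `[x_k, [x_{k+1}, […, x_{k+r}]…]]`. -/
def rightWord (n : ℕ) [NeZero n] (k : ℕ) : ℕ → FreeMagma (Fin n)
  | 0 => .of (letter n k)
  | r + 1 => .of (letter n k) * rightWord n (k + 1) r

/-- The element `u[k,m]` of `U_q^+(so_{2n+1})`, for `1 ≤ k ≤ m ≤ 2n`.  In the case
`m = ψ(k) = 2n - k + 1` it is `β [u[n+1,m], u[k,n]]` with `β = -p(u(n+1,m), u(k,n))⁻¹`, where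
`u[n+1,m]` is bracketed from the right and `u[k,n]` from the left. -/
noncomputable def u (P : BParam F n) (k m : ℕ) : P.U :=
  if m < 2 * n + 1 - k then P.bracket P.X (leftWord n k (m - k))
  else if 2 * n + 1 - k < m then P.bracket P.X (rightWord n k (m - k))
  else
    (-((P.chr (rightWord n (n + 1) (m - (n + 1))) (P.gr (leftWord n k (n - k))) : F))⁻¹) •
      P.bracket P.X (rightWord n (n + 1) (m - (n + 1)) * leftWord n k (n - k))

/-- The product `g_k g_{k+1} ⋯ g_i` in `U_q^+(so_{2n+1})`, where `g_j = g_{2n-j+1}` for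
`n < j ≤ 2n`. -/
noncomputable def gProd (P : BParam F n) (k i : ℕ) : P.U :=
  P.grp (∏ j ∈ Finset.Icc k i, P.g (letter n j))

/-- The scalars `τ_i`: `τ_n = q` and `τ_i = 1` for `i ≠ n`. -/
def τ (P : BParam F n) (i : ℕ) : F := if i = n then (P.q : F) else 1

end Elements

end BParam

/-!
The coproduct of `u[k,m]` is computed by induction on `m`, for all `k` at once, by multiplying by
the letter `x_{m+1}` on the right. Write `ψ(k) = 2n + 1 - k`. In every case `u[k,m+1]` is
expressed through the bracket `a x - μ p(a,x) x a` with `a = u[k,m]`, `x = x_{m+1}`: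

* `μ = 1` if `m + 1 < ψ(k)` (the definition) or `ψ(k) + 1 < m + 1` (`u_succ_of_lt`);
* `μ = q⁻²` if `m + 1 = ψ(k)` (`u_mid_eq_br`);
* `μ = q²` if `m + 1 = ψ(k) + 1`, with an additional multiple of `u[k-1,m]` (`u_mid_succ_eq`).

By `comulHom_br`, the coproduct of such a bracket is determined by deformed brackets of the tensor
factors `u[i+1,m]` and `u[k,i]` with `x`.  If `m ≠ ψ(k)`, then for most `i` the first is
`u[i+1,m+1]` and the second vanishes.  The exceptional `i` are those for which `x_i` or `x_{i+1}` is
the mirror image of `x_{m+1}`; their deviations cancel because of the formulas for `u[j,ψ(j)]` and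
`u[j+1,ψ(j)]`, where `j = ψ(m+1)`.  If `m = ψ(k)`, the brackets of `u[k,i]` with `x` do not vanish,
but they cancel against the coproduct of the additional multiple of `u[k-1,m]`.

The scalars depend only on the products `p(u,v) p(v,u)`, which are powers of `q` given by the
pairing of weights (`pp_mul_pp`). Of the Serre relations, the proof uses those of degree at most
three, and their consequence `[[[a,b],c],b] = 0` for consecutive letters with `b ≠ x_n`
(`br_br_mid_eq_zero`); this is where `q² ≠ -1` enters.
-/

namespace BParam

/-! ### Skew commutators -/

section Bracket

variable {F A : Type*} [Field F] [Ring A] [Algebra F A]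

/-- The skew commutator `[a, b] = a b - c b a` with an explicit scalar `c`. -/
def br (c : F) (a b : A) : A := a * b - c • (b * a)

theorem br_eq_zero_iff {c : F} {a b : A} : br c a b = 0 ↔ a * b = c • (b * a) := sub_eq_zero

/-- Skew commutators reassociate, `[a, [b, c]] = [[a, b], c]`, when `a` and `c` skew commute. -/
theorem br_br_of_skew {a b c : A} {α β γ : F} (h : a * c = γ • (c * a)) :
    br (α * γ) a (br β b c) = br (γ * β) (br α a b) c := by
  have h' := assoc_rule h
  simp only [br, mul_sub, sub_mul, smul_sub, mul_assoc, smul_mul_assoc, mul_smul_comm, smul_smul,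
    h, h']
  match_scalars <;> ring

theorem br_mul_skew {a b y : A} {α β c : F} (ha : a * y = α • (y * a)) (hb : b * y = β • (y * b)) :
    br c a b * y = (α * β) • (y * br c a b) := by
  have ha' := assoc_rule ha
  have hb' := assoc_rule hb
  simp only [br, mul_sub, sub_mul, smul_sub, mul_assoc, smul_mul_assoc, mul_smul_comm, smul_smul,
    ha, hb, ha', hb']
  match_scalars <;> ring

theorem skew_symm {a b : A} {c d : F} (hcd : c * d = 1) (h : a * b = c • (b * a)) :
    b * a = d • (a * b) := by
  rw [h, smul_smul, mul_comm d, hcd, one_smul]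

theorem skew_mul_br {a b y : A} {α β c : F} (ha : y * a = α • (a * y)) (hb : y * b = β • (b * y)) :
    y * br c a b = (α * β) • (br c a b * y) := by
  have ha' := assoc_rule ha
  have hb' := assoc_rule hb
  simp only [br, mul_sub, sub_mul, smul_sub, mul_assoc, smul_mul_assoc, mul_smul_comm, smul_smul,
    ha, hb, ha', hb']
  match_scalars <;> ring

/-- When `p(x,y) p(y,x) = p(x,x)⁻¹`, the two sides are equal up to a nonzero scalar, so the
relation `[x, [x, y]] = 0` may be read from either side. -/
theorem br_br_right_of_left {x y : A} {s c d : F} (hs : s ≠ 0) (hcd : c * d = s⁻¹)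
    (h : br (s * c) x (br c x y) = 0) : br (d * s) (br d y x) x = 0 := by
  have hc : c ≠ 0 := by rintro rfl; simp [eq_comm, hs] at hcd
  have hd : d = s⁻¹ * c⁻¹ := by field_simp at hcd ⊢; linear_combination hcd
  subst hd
  have : br ((s⁻¹ * c⁻¹) * s) (br (s⁻¹ * c⁻¹) y x) x
      = (s⁻¹ * c⁻¹ * c⁻¹) • br (s * c) x (br c x y) := by
    simp only [br, mul_sub, sub_mul, smul_sub, mul_assoc, smul_mul_assoc, mul_smul_comm, smul_smul]
    match_scalars <;> field_simp
  rw [this, h, smul_zero]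

/-- The converse of `br_br_right_of_left`. -/
theorem br_br_left_of_right {x y : A} {s c d : F} (hs : s ≠ 0) (hcd : c * d = s⁻¹)
    (h : br (d * s) (br d y x) x = 0) : br (s * c) x (br c x y) = 0 := by
  have hc : c ≠ 0 := by rintro rfl; simp [eq_comm, hs] at hcd
  have hd : d = s⁻¹ * c⁻¹ := by field_simp at hcd ⊢; linear_combination hcd
  subst hd
  have : br (s * c) x (br c x y) = (s * c * c) • br ((s⁻¹ * c⁻¹) * s) (br (s⁻¹ * c⁻¹) y x) x := by
    simp only [br, mul_sub, sub_mul, smul_sub, mul_assoc, smul_mul_assoc, mul_smul_comm, smul_smul]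
    match_scalars <;> field_simp
  rw [this, h, smul_zero]

/-- If `[[a, b], b] = 0` and `[b, [b, c]] = 0`, and if `a`, `c` skew commute, then
`[[[a, b], c], b] = 0`.  The relations yield only the multiple by `1 + p(b,b)`. -/
theorem br_br_mid_eq_zero {a b c : A} {s ab ba bc cb ac : F} (hs : s ≠ 0) (hs1 : s + 1 ≠ 0)
    (h1 : ab * ba = s⁻¹) (h2 : bc * cb = s⁻¹)
    (hab : br (ab * s) (br ab a b) b = 0) (hbc : br (s * bc) b (br bc b c) = 0)
    (hac : a * c = ac • (c * a)) :
    br (ab * s * cb) (br (ac * bc) (br ab a b) c) b = 0 := by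
  have hab0 : ab ≠ 0 := by rintro rfl; simp [eq_comm, hs] at h1
  have hbc0 : bc ≠ 0 := by rintro rfl; simp [eq_comm, hs] at h2
  have hba : ba = s⁻¹ * ab⁻¹ := by field_simp at h1 ⊢; linear_combination h1
  have hcb : cb = s⁻¹ * bc⁻¹ := by field_simp at h2 ⊢; linear_combination h2
  subst hba hcb
  have e : (s + 1) • br (ab * s * (s⁻¹ * bc⁻¹)) (br (ac * bc) (br ab a b) c) b = 0 := by
    have hac' := assoc_rule hac
    -- The coefficients are found by comparing monomials after moving `c` to the left of `a`.
    have e' : (s + 1) • br (ab * s * (s⁻¹ * bc⁻¹)) (br (ac * bc) (br ab a b) c) b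
        = bc⁻¹ • (br (ab * s) (br ab a b) b * c - a * br (s * bc) b (br bc b c))
          + (ac * ab ^ 2 * bc⁻¹) • (br (s * bc) b (br bc b c) * a)
          - (ac * bc) • (c * br (ab * s) (br ab a b) b) := by
      simp only [br, mul_sub, sub_mul, smul_sub, mul_assoc, smul_mul_assoc, mul_smul_comm,
        smul_smul, hac, hac']
      match_scalars <;> field_simp <;> ring
    rw [e', hab, hbc]
    simp
  exact (smul_eq_zero.1 e).resolve_left hs1

theorem br_add_left (c : F) (a a' b : A) :
    br c (a + a') b = br c a b + br c a' b := by
  simp only [br, add_mul, mul_add, smul_add]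
  abel

theorem br_smul_left (c d : F) (a b : A) :
    br c (d • a) b = d • br c a b := by
  simp only [br, smul_mul_assoc, mul_smul_comm, smul_sub, smul_comm c d]

theorem br_sum_left {ι : Type*} (c : F) (s : Finset ι) (f : ι → A)
    (b : A) : br c (∑ i ∈ s, f i) b = ∑ i ∈ s, br c (f i) b := by
  simp only [br, Finset.sum_mul, Finset.mul_sum, Finset.smul_sum, Finset.sum_sub_distrib]

/-- The formal identity behind `u_mid_eq_br`, with `a = u[k,n]`, `b = u[n+1,ψ(k)-1]`, `x = x_k`; the
scalar `ab` stands for `p(a,b)`, and similarly for the others. -/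
theorem br_mid_formula {a b x : A} {q ab ba bx xa ax : F} (hq : q ≠ 0) (h1 : ab * ba = 1)
    (h2 : xa * ax = q ^ 2) (hxa : x * a = xa • (a * x)) :
    (-(ba * xa)⁻¹) • br (ba * xa) (br bx b x) a = br ((q ^ 2)⁻¹ * (ax * bx)) (br ab a b) x := by
  have hxa0 : xa ≠ 0 := left_ne_zero_of_mul (h2.trans_ne (pow_ne_zero 2 hq))
  have hba : ba ≠ 0 := by rintro rfl; simp at h1
  obtain rfl : ab = ba⁻¹ := by field_simp; exact h1
  obtain rfl : ax = q ^ 2 * xa⁻¹ := by field_simp; linear_combination h2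
  have hxa' := assoc_rule hxa
  simp only [br, mul_sub, sub_mul, smul_sub, mul_assoc, smul_mul_assoc, mul_smul_comm, smul_smul,
    hxa, hxa']
  match_scalars <;> field_simp

/-- The formal identity behind `u_mid_succ_eq`, with `a = u[k,n]`, `b = u[n+1,ψ(k)]`,
`x = x_{k-1}`.  No relation between `a`, `b`, `x` is needed. -/
theorem br_mid_succ_formula {a b x : A} {q ab ba bx xb xa ax : F} (hq : q ≠ 0)
    (h1 : ab * ba = q ^ 2) (h2 : ax * xa = (q ^ 2)⁻¹) (h3 : bx * xb = (q ^ 2)⁻¹) :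
    br (ab * ax) a (br bx b x) = br (q ^ 2 * (ax * bx)) ((-ba⁻¹) • br ba b a) x
      + (q ^ 2 * (ax * bx)) • br (xb * ab) (br xa x a) b := by
  have hq2 : q ^ 2 ≠ 0 := pow_ne_zero _ hq
  have hax : ax ≠ 0 := left_ne_zero_of_mul (h2.trans_ne (inv_ne_zero hq2))
  have hbx : bx ≠ 0 := left_ne_zero_of_mul (h3.trans_ne (inv_ne_zero hq2))
  have hba : ba ≠ 0 := right_ne_zero_of_mul (h1.trans_ne hq2)
  obtain rfl : ab = q ^ 2 * ba⁻¹ := by field_simp; exact h1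
  obtain rfl : xa = (q ^ 2)⁻¹ * ax⁻¹ := by field_simp at h2 ⊢; linear_combination h2
  obtain rfl : xb = (q ^ 2)⁻¹ * bx⁻¹ := by field_simp at h3 ⊢; linear_combination h3
  simp only [br, mul_sub, sub_mul, smul_sub, mul_assoc, smul_mul_assoc, mul_smul_comm, smul_smul]
  match_scalars <;> field_simp <;> ring

end Bracket

/-! ### Products over intervals and the weight pairing -/

theorem prod_Icc_split {M : Type*} [CommMonoid M] (f : ℕ → M) {k i m : ℕ} (h1 : k ≤ i + 1)
    (h2 : i ≤ m) :
    ∏ t ∈ Finset.Icc k m, f t = (∏ t ∈ Finset.Icc k i, f t) * ∏ t ∈ Finset.Icc (i + 1) m, f t := by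
  simp only [← Finset.Ico_add_one_right_eq_Icc]
  exact (Finset.prod_Ico_consecutive f h1 (by omega)).symm

theorem prod_Icc_top {M : Type*} [CommMonoid M] (f : ℕ → M) (k r : ℕ) :
    ∏ t ∈ Finset.Icc k (k + r + 1), f t = (∏ t ∈ Finset.Icc k (k + r), f t) * f (k + r + 1) := by
  rw [prod_Icc_split f (show k ≤ k + r + 1 by omega) (k + r).le_succ, Finset.Icc_self,
    Finset.prod_singleton]

theorem prod_Icc_bot {M : Type*} [CommMonoid M] (f : ℕ → M) (k r : ℕ) :
    ∏ t ∈ Finset.Icc k (k + (r + 1)), f t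
      = f k * ∏ t ∈ Finset.Icc (k + 1) (k + 1 + r), f t := by
  rw [prod_Icc_split f k.le_succ (show k ≤ k + (r + 1) by omega), Finset.Icc_self,
    Finset.prod_singleton, show k + (r + 1) = k + 1 + r by ring]

/-- The pairing `(e_s, e_t)` of the vectors `e_1, …, e_n, 0, -e_n, …, -e_1` (numbered from `1` to
`2n + 1`), where `e_1, …, e_n` are orthogonal of square length two.  The weight of `u[k,m]` is
`e_k - e_{m+1}`. -/
def epair (n s t : ℕ) : ℤ := (if s = t then 2 else 0) - (if s + t = 2 * n + 2 then 2 else 0)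

theorem epair_comm (n s t : ℕ) : epair n s t = epair n t s := by
  simp only [epair, eq_comm (a := s), add_comm s]

theorem epair_reflect {n s : ℕ} (hs : s ≤ 2 * n + 2) (t : ℕ) :
    epair n (2 * n + 2 - s) t = -epair n s t := by
  simp only [epair, show 2 * n + 2 - s = t ↔ s + t = 2 * n + 2 by omega,
    show 2 * n + 2 - s + t = 2 * n + 2 ↔ s = t by omega, neg_sub]

theorem epair_far {n s t : ℕ} (h1 : s ≠ t) (h2 : s + t ≠ 2 * n + 2) : epair n s t = 0 := by
  simp [epair, h1, h2]

theorem epair_self {n s : ℕ} (h : s ≠ n + 1) : epair n s s = 2 := by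
  simp [epair, show s + s ≠ 2 * n + 2 by omega]

theorem epair_opp {n s t : ℕ} (h : s ≠ t) (h2 : s + t = 2 * n + 2) : epair n s t = -2 := by
  simp [epair, h, h2]

theorem epair_zero {n t : ℕ} : epair n (n + 1) t = 0 := by
  simp only [epair, show n + 1 = t ↔ n + 1 + t = 2 * n + 2 by omega, sub_self]

/-! ### Scalars of pairs of intervals -/

variable {F : Type*} [Field F] {n : ℕ}

theorem chr_mul (P : BParam F n) (v w : FreeMagma (Fin n)) :
    P.chr (v * w) = P.chr v * P.chr w := rfl

theorem gr_mul (P : BParam F n) (v w : FreeMagma (Fin n)) :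
    P.gr (v * w) = P.gr v * P.gr w := rfl

theorem grp_mul_comm (P : BParam F n) (a b : P.G) :
    P.grp a * P.grp b = P.grp b * P.grp a := by
  rw [← grp_mul, mul_comm, grp_mul]

theorem sq_add_one_ne_zero (P : BParam F n) (hq4 : P.q ^ 4 ≠ 1) : (P.q : F) ^ 2 + 1 ≠ 0 := by
  intro h
  refine hq4 (Units.ext ?_)
  push_cast
  linear_combination ((P.q : F) ^ 2 - 1) * h

variable [NeZero n]

/-- The scalar `p(u(k,m), u(l,r))`, where `u(k,m) = x_k x_{k+1} ⋯ x_m`. -/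
def pp (P : BParam F n) (k m l r : ℕ) : F :=
  ∏ s ∈ Finset.Icc k m, ∏ t ∈ Finset.Icc l r, (P.p (letter n s) (letter n t) : F)

theorem pp_self (P : BParam F n) (i j : ℕ) :
    P.pp i i j j = (P.p (letter n i) (letter n j) : F) := by simp [pp]

theorem pp_ne_zero (P : BParam F n) (k m l r : ℕ) : P.pp k m l r ≠ 0 :=
  Finset.prod_ne_zero_iff.2 fun _ _ => Finset.prod_ne_zero_iff.2 fun _ _ => Units.ne_zero _

theorem pp_split_left (P : BParam F n) {k i m : ℕ} (l r : ℕ) (h1 : k ≤ i + 1) (h2 : i ≤ m) :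
    P.pp k m l r = P.pp k i l r * P.pp (i + 1) m l r :=
  prod_Icc_split _ h1 h2

theorem pp_split_right (P : BParam F n) (k m : ℕ) {l i r : ℕ} (h1 : l ≤ i + 1) (h2 : i ≤ r) :
    P.pp k m l r = P.pp k m l i * P.pp k m (i + 1) r := by
  simp only [pp, prod_Icc_split _ h1 h2, Finset.prod_mul_distrib]

theorem letter_congr {i : ℕ} (h2 : i ≤ 2 * n) : letter n (2 * n + 1 - i) = letter n i := by
  rcases Nat.eq_zero_or_pos i with rfl | h
  · have := NeZero.pos n
    simp [letter, show ¬ (2 * n + 1 ≤ n) by omega]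
  unfold letter
  congr 1
  split_ifs <;> omega

theorem val_letter {i : ℕ} (h1 : 1 ≤ i) (h2 : i ≤ n) : (letter n i : ℕ) = i - 1 := by
  rw [letter, if_pos h2]
  exact Nat.mod_eq_of_lt (by omega)

theorem pp_reflect_left (P : BParam F n) {i : ℕ} (hi : i ≤ 2 * n) (l r : ℕ) :
    P.pp (2 * n + 1 - i) (2 * n + 1 - i) l r = P.pp i i l r := by
  simp [pp, letter_congr hi]

theorem pp_reflect_right (P : BParam F n) {i : ℕ} (hi : i ≤ 2 * n) (l r : ℕ) :
    P.pp l r (2 * n + 1 - i) (2 * n + 1 - i) = P.pp l r i i := by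
  simp [pp, letter_congr hi]

/-- The symmetrized parameters are `p(x_s,x_t) p(x_t,x_s) = q^(w_s, w_t)`, where
`w_s = e_s - e_{s+1}` is the weight of `x_s`. -/
theorem p_mul_p (P : BParam F n) {s t : ℕ} (hs : 1 ≤ s) (hs' : s ≤ 2 * n) (ht : 1 ≤ t)
    (ht' : t ≤ 2 * n) :
    (P.p (letter n s) (letter n t) : F) * P.p (letter n t) (letter n s)
      = (P.q : F) ^ (epair n s t - epair n s (t + 1) - epair n (s + 1) t
          + epair n (s + 1) (t + 1)) := by
  wlog hsn : s ≤ n generalizing s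
  · have := this (s := 2 * n + 1 - s) (by omega) (by omega) (by omega)
    rw [letter_congr hs', show 2 * n + 1 - s + 1 = 2 * n + 2 - s by omega,
      show 2 * n + 1 - s = 2 * n + 2 - (s + 1) by omega] at this
    simp only [epair_reflect (show s ≤ 2 * n + 2 by omega),
      epair_reflect (show s + 1 ≤ 2 * n + 2 by omega)] at this
    rw [this]
    congr 1
    ring
  wlog htn : t ≤ n generalizing t
  · have := this (t := 2 * n + 1 - t) (by omega) (by omega) (by omega)
    rw [letter_congr ht', show 2 * n + 1 - t + 1 = 2 * n + 2 - t by omega,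
      show 2 * n + 1 - t = 2 * n + 2 - (t + 1) by omega] at this
    simp only [epair_comm n s, epair_comm n (s + 1),
      epair_reflect (show t ≤ 2 * n + 2 by omega),
      epair_reflect (show t + 1 ≤ 2 * n + 2 by omega)] at this ⊢
    rw [this]
    congr 1
    ring
  wlog hst : s ≤ t generalizing s t
  · rw [mul_comm (P.p (letter n s) (letter n t) : F),
      this ht ht' htn hs hs' hsn (by omega)]
    simp only [epair_comm n s, epair_comm n (s + 1)]
    congr 1
    ring
  have vs := val_letter hs hsn
  have vt := val_letter ht htn
  have key : ∀ e : ℤ, epair n s t - epair n s (t + 1) - epair n (s + 1) t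
          + epair n (s + 1) (t + 1) = e →
        P.p (letter n s) (letter n t) * P.p (letter n t) (letter n s) = P.q ^ e →
      (P.p (letter n s) (letter n t) : F) * P.p (letter n t) (letter n s)
      = (P.q : F) ^ (epair n s t - epair n s (t + 1) - epair n (s + 1) t
          + epair n (s + 1) (t + 1)) := fun e he h => by
    rw [he]; exact_mod_cast congrArg Units.val h
  rcases Nat.eq_or_lt_of_le hst with rfl | hlt
  · rcases Nat.eq_or_lt_of_le hsn with rfl | hlt
    · refine key 2 ?_ ?_
      · rw [epair_zero, epair_zero, epair_self (by omega), epair_far (by omega) (by omega)]; rfl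
      · rw [P.p_last _ (by omega)]; norm_cast; exact (sq _).symm
    · refine key 4 ?_ ?_
      · rw [epair_self (by omega), epair_self (by omega), epair_far (by omega) (by omega),
          epair_far (by omega) (by omega)]; rfl
      · rw [P.p_diag _ (by omega)]; norm_cast; rw [← pow_add]
  · rcases Nat.eq_or_lt_of_le (Nat.succ_le_of_lt hlt) with h | h
    · refine key (-2) ?_ ?_
      · rw [epair_far (by omega) (by omega), epair_far (by omega) (by omega), ← h,
          epair_self (by omega), epair_far (by omega) (by omega)]; rfl
      · rw [P.p_adj _ _ (by omega), zpow_neg]; norm_cast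
    · refine key 0 ?_ ?_
      · rw [epair_far (by omega) (by omega), epair_far (by omega) (by omega),
          epair_far (by omega) (by omega), epair_far (by omega) (by omega)]; rfl
      · rw [P.p_far _ _ (by omega), zpow_zero]

/-- `p(u,v) p(v,u) = q^(wt u, wt v)` for `u = u(k,m)` and `v = u(l,r)`: the weights telescope. -/
theorem pp_mul_pp (P : BParam F n) {k m l r : ℕ} (hk : 1 ≤ k) (hkm : k ≤ m) (hm : m ≤ 2 * n)
    (hl : 1 ≤ l) (hlr : l ≤ r) (hr : r ≤ 2 * n) :
    P.pp k m l r * P.pp l r k m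
      = (P.q : F) ^ (epair n k l - epair n k (r + 1) - epair n (m + 1) l
          + epair n (m + 1) (r + 1)) := by
  have hq : (P.q : F) ≠ 0 := Units.ne_zero _
  induction m, hkm using Nat.le_induction with
  | base =>
    induction r, hlr using Nat.le_induction with
    | base => simpa only [pp_self] using P.p_mul_p hk hm hl hr
    | succ r hlr ih =>
      rw [P.pp_split_right _ _ (show l ≤ r + 1 by omega) r.le_succ,
        P.pp_split_left _ _ (show l ≤ r + 1 by omega) r.le_succ, mul_mul_mul_comm, ih (by omega),
        pp_self, pp_self, P.p_mul_p hk hm (by omega) hr, ← zpow_add₀ hq]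
      congr 1; ring
  | succ m hkm ih =>
    have key : P.pp (m + 1) (m + 1) l r * P.pp l r (m + 1) (m + 1) = (P.q : F) ^
        (epair n (m + 1) l - epair n (m + 1) (r + 1) - epair n (m + 1 + 1) l
          + epair n (m + 1 + 1) (r + 1)) := by
      clear ih
      induction r, hlr using Nat.le_induction with
      | base => simpa only [pp_self] using P.p_mul_p (by omega) hm hl hr
      | succ r hlr ih =>
        rw [P.pp_split_right _ _ (show l ≤ r + 1 by omega) r.le_succ,
          P.pp_split_left _ _ (show l ≤ r + 1 by omega) r.le_succ, mul_mul_mul_comm, ih (by omega),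
          pp_self, pp_self, P.p_mul_p (by omega) hm (by omega) hr, ← zpow_add₀ hq]
        congr 1; ring
    rw [P.pp_split_left _ _ (show k ≤ m + 1 by omega) m.le_succ,
      P.pp_split_right _ _ (show k ≤ m + 1 by omega) m.le_succ, mul_mul_mul_comm, ih (by omega),
      key, ← zpow_add₀ hq]
    congr 1; ring

theorem pp_mul_pp_eq (P : BParam F n) {k m l r : ℕ} {e : ℤ} (hk : 1 ≤ k) (hkm : k ≤ m)
    (hm : m ≤ 2 * n) (hl : 1 ≤ l) (hlr : l ≤ r) (hr : r ≤ 2 * n)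
    (he : epair n k l - epair n k (r + 1) - epair n (m + 1) l + epair n (m + 1) (r + 1) = e) :
    P.pp k m l r * P.pp l r k m = (P.q : F) ^ e := by
  rw [pp_mul_pp P hk hkm hm hl hlr hr, he]

theorem pp_diag (P : BParam F n) {i : ℕ} (hi : 1 ≤ i) (hin : i < n) :
    P.pp i i i i = (P.q : F) ^ 2 := by
  rw [pp_self, P.p_diag _ (by rw [val_letter hi hin.le]; omega), Units.val_pow_eq_pow_val]

theorem pp_diag_last (P : BParam F n) : P.pp n n n n = (P.q : F) := by
  rw [pp_self, P.p_last _ (by rw [val_letter NeZero.one_le le_rfl]; have := NeZero.pos n; omega)]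

theorem pp_diag_reflect (P : BParam F n) {i : ℕ} (hi : n + 1 < i) (hin : i ≤ 2 * n) :
    P.pp i i i i = (P.q : F) ^ 2 := by
  rw [← pp_reflect_left P hin, ← pp_reflect_right P hin, P.pp_diag (by omega) (by omega)]

theorem pp_adj (P : BParam F n) {i : ℕ} (hi : 1 ≤ i) (hin : i < 2 * n) (h : i ≠ n) :
    P.pp i i (i + 1) (i + 1) * P.pp (i + 1) (i + 1) i i = ((P.q : F) ^ 2)⁻¹ := by
  have : epair n i (i + 1) - epair n i (i + 1 + 1) - epair n (i + 1) (i + 1)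
      + epair n (i + 1) (i + 1 + 1) = -2 := by
    simp (disch := omega) only [epair_far, epair_self]
    norm_num
  rw [P.pp_mul_pp_eq hi le_rfl hin.le (by omega) le_rfl hin this, zpow_neg, zpow_ofNat]

theorem pp_mul_pp_of_far (P : BParam F n) {k i j : ℕ} (hk : 1 ≤ k) (hki : k ≤ i) (hij : i + 2 ≤ j)
    (hj : j ≤ 2 * n) (h : i + j < 2 * n ∨ 2 * n + 2 < k + j) :
    P.pp k i j j * P.pp j j k i = 1 := by
  refine (P.pp_mul_pp_eq (e := 0) hk hki (by omega) (by omega) le_rfl hj ?_).trans (zpow_zero _)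
  simp (disch := omega) only [epair_far]
  norm_num

/-! ### Recursion and weights of the elements `u[k,m]` -/

/-- The letter `x_i`, `1 ≤ i ≤ 2n`, where `x_i = x_{2n-i+1}` for `n < i`. -/
noncomputable def x (P : BParam F n) (i : ℕ) : P.U := P.X (letter n i)

theorem x_reflect (P : BParam F n) {i : ℕ} (hi : i ≤ 2 * n) : P.x (2 * n + 1 - i) = P.x i := by
  rw [x, letter_congr hi, x]

theorem chr_leftWord (P : BParam F n) (k r : ℕ) :
    P.chr (leftWord n k r) = ∏ t ∈ Finset.Icc k (k + r), P.χ (letter n t) := by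
  induction r with
  | zero => simp [leftWord]; rfl
  | succ r ih => rw [leftWord, chr_mul, ih, ← add_assoc, prod_Icc_top]; rfl

theorem gr_leftWord (P : BParam F n) (k r : ℕ) :
    P.gr (leftWord n k r) = ∏ t ∈ Finset.Icc k (k + r), P.g (letter n t) := by
  induction r with
  | zero => simp [leftWord]; rfl
  | succ r ih => rw [leftWord, gr_mul, ih, ← add_assoc, prod_Icc_top]; rfl

theorem chr_rightWord (P : BParam F n) (k r : ℕ) :
    P.chr (rightWord n k r) = ∏ t ∈ Finset.Icc k (k + r), P.χ (letter n t) := by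
  induction r generalizing k with
  | zero => simp [rightWord]; rfl
  | succ r ih => rw [rightWord, chr_mul, ih, prod_Icc_bot]; rfl

theorem gr_rightWord (P : BParam F n) (k r : ℕ) :
    P.gr (rightWord n k r) = ∏ t ∈ Finset.Icc k (k + r), P.g (letter n t) := by
  induction r generalizing k with
  | zero => simp [rightWord]; rfl
  | succ r ih => rw [rightWord, gr_mul, ih, prod_Icc_bot]; rfl

theorem prod_χ_prod_g (P : BParam F n) (k m l r : ℕ) :
    (((∏ s ∈ Finset.Icc k m, P.χ (letter n s)) (∏ t ∈ Finset.Icc l r, P.g (letter n t)) : Fˣ) : F)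
      = P.pp k m l r := by
  simp [pp, χ_g, Finset.prod_comm (s := Finset.Icc l r)]

theorem u_self (P : BParam F n) {k : ℕ} (hk : k ≤ 2 * n) : P.u k k = P.x k := by
  unfold u
  split_ifs
  · simp [leftWord]; rfl
  · simp [rightWord]; rfl
  · omega

theorem u_left (P : BParam F n) {k m : ℕ} (hkm : k ≤ m) (h : m + 1 < 2 * n + 1 - k) :
    P.u k (m + 1) = br (P.pp k m (m + 1) (m + 1)) (P.u k m) (P.x (m + 1)) := by
  obtain ⟨r, rfl⟩ := Nat.exists_eq_add_of_le hkm
  rw [u, if_pos h, u, if_pos (by omega), show k + r + 1 - k = r + 1 by omega,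
    show k + r - k = r by omega]
  have : ∀ v w, P.bracket P.X (v * w) = br (P.chr v (P.gr w) : F) (P.bracket P.X v)
    (P.bracket P.X w) := fun _ _ => rfl
  rw [leftWord, this, chr_leftWord, ← prod_χ_prod_g, Finset.Icc_self, Finset.prod_singleton]
  rfl

theorem u_right (P : BParam F n) {k m : ℕ} (hkm : k < m) (h : 2 * n + 1 - k < m) :
    P.u k m = br (P.pp k k (k + 1) m) (P.x k) (P.u (k + 1) m) := by
  obtain ⟨r, rfl⟩ := Nat.exists_eq_add_of_lt hkm
  rw [u, if_neg (by omega), if_pos h, u, if_neg (by omega), if_pos (by omega),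
    show k + r + 1 - k = r + 1 by omega, show k + r + 1 - (k + 1) = r by omega]
  have : ∀ v w, P.bracket P.X (v * w) = br (P.chr v (P.gr w) : F) (P.bracket P.X v)
    (P.bracket P.X w) := fun _ _ => rfl
  rw [rightWord, this, gr_rightWord, ← prod_χ_prod_g, Finset.Icc_self, Finset.prod_singleton,
    show k + 1 + r = k + r + 1 by ring]
  rfl

theorem u_mid (P : BParam F n) {k : ℕ} (hk : 1 ≤ k) (hkn : k ≤ n) :
    P.u k (2 * n + 1 - k) = (-(P.pp (n + 1) (2 * n + 1 - k) k n)⁻¹) •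
      br (P.pp (n + 1) (2 * n + 1 - k) k n) (P.u (n + 1) (2 * n + 1 - k)) (P.u k n) := by
  rw [u, if_neg (by omega), if_neg (by omega), u, if_neg (by omega), if_pos (by omega), u,
    if_pos (by omega), chr_rightWord, gr_leftWord, prod_χ_prod_g,
    show n + 1 + (2 * n + 1 - k - (n + 1)) = 2 * n + 1 - k by omega, show k + (n - k) = n by omega]
  have : ∀ v w, P.bracket P.X (v * w) = br (P.chr v (P.gr w) : F) (P.bracket P.X v)
    (P.bracket P.X w) := fun _ _ => rfl
  rw [this, chr_rightWord, gr_leftWord, prod_χ_prod_g,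
    show n + 1 + (2 * n + 1 - k - (n + 1)) = 2 * n + 1 - k by omega, show k + (n - k) = n by omega]

/-- An element that skew commutes with the letters `x_k, …, x_m` skew commutes with `u[k,m]`. -/
theorem u_mul_skew (P : BParam F n) {y : P.U} {c : ℕ → F} {k m : ℕ} (hk : 1 ≤ k) (hkm : k ≤ m)
    (hm : m ≤ 2 * n) (h : ∀ t ∈ Finset.Icc k m, P.x t * y = c t • (y * P.x t)) :
    P.u k m * y = (∏ t ∈ Finset.Icc k m, c t) • (y * P.u k m) := by
  have left : ∀ l r, k ≤ l → l ≤ r → r ≤ m → r < 2 * n + 1 - l →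
      P.u l r * y = (∏ t ∈ Finset.Icc l r, c t) • (y * P.u l r) := by
    intro l r hl hlr hr hlt
    induction r, hlr using Nat.le_induction with
    | base => simpa [u_self P (hr.trans hm)] using h l (Finset.mem_Icc.2 ⟨hl, hr⟩)
    | succ r hlr ih =>
      rw [u_left P hlr hlt, br_mul_skew (ih (by omega) (by omega))
        (h (r + 1) (Finset.mem_Icc.2 ⟨by omega, hr⟩)),
        prod_Icc_split c (show l ≤ r + 1 by omega) r.le_succ, Finset.Icc_self,
        Finset.prod_singleton]
  have right : ∀ l r, k ≤ l → l ≤ r → r ≤ m → 2 * n + 1 - l < r →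
      P.u l r * y = (∏ t ∈ Finset.Icc l r, c t) • (y * P.u l r) := by
    intro l r hl hlr hr hlt
    induction hlr using Nat.decreasingInduction with
    | self => simpa [u_self P (hr.trans hm)] using h r (Finset.mem_Icc.2 ⟨hl, hr⟩)
    | of_succ l hlr ih =>
      rw [u_right P hlr hlt, br_mul_skew (h l (Finset.mem_Icc.2 ⟨hl, by omega⟩))
        (ih (by omega) (by omega)), prod_Icc_split c l.le_succ hlr.le, Finset.Icc_self,
        Finset.prod_singleton]
  rcases lt_trichotomy m (2 * n + 1 - k) with hlt | rfl | hlt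
  · exact left k m le_rfl hkm le_rfl hlt
  · rw [u_mid P hk (by omega), smul_mul_assoc,
      br_mul_skew (right (n + 1) _ (by omega) (by omega) le_rfl (by omega))
        (left k n le_rfl (by omega) (by omega) (by omega)),
      prod_Icc_split c (show k ≤ n + 1 by omega) (show n ≤ 2 * n + 1 - k by omega), mul_smul_comm,
      smul_comm, mul_comm (∏ t ∈ Finset.Icc k n, c t)]
  · exact right k m le_rfl hkm le_rfl hlt

theorem x_mul_grp_g (P : BParam F n) (i j : ℕ) :
    P.x i * P.grp (P.g (letter n j))
      = (P.p (letter n i) (letter n j) : F) • (P.grp (P.g (letter n j)) * P.x i) :=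
  P.X_mul_grp _ _

theorem u_mul_grp_g (P : BParam F n) {k m : ℕ} (hk : 1 ≤ k) (hkm : k ≤ m)
    (hm : m ≤ 2 * n) (j : ℕ) :
    P.u k m * P.grp (P.g (letter n j))
      = P.pp k m j j • (P.grp (P.g (letter n j)) * P.u k m) := by
  rw [P.u_mul_skew hk hkm hm fun t _ => P.x_mul_grp_g t j]
  simp [pp]

theorem x_mul_gProd (P : BParam F n) (i k m : ℕ) :
    P.x i * P.gProd k m = P.pp i i k m • (P.gProd k m * P.x i) := by
  rw [gProd, x, X_mul_grp]
  simp [pp, χ_g]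

theorem gProd_self (P : BParam F n) (k : ℕ) : P.gProd k k = P.grp (P.g (letter n k)) := by
  simp [gProd]

theorem gProd_succ (P : BParam F n) {k m : ℕ} (h : k ≤ m + 1) :
    P.gProd k (m + 1) = P.gProd k m * P.grp (P.g (letter n (m + 1))) := by
  rw [gProd, prod_Icc_split _ h m.le_succ, grp_mul, Finset.Icc_self, Finset.prod_singleton, gProd]

/-! ### Relations between the elements `u[k,m]` -/

/-- Letters that are neither equal nor neighbours skew commute; the condition on `s + t` says that
`x_s` is not one of `x_{ψ(t)-1}, x_{ψ(t)}, x_{ψ(t)+1}`. -/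
theorem x_mul_x_of_far (P : BParam F n) {s t : ℕ} (hs : 1 ≤ s) (hst : s + 2 ≤ t) (ht : t ≤ 2 * n)
    (h : s + t < 2 * n ∨ 2 * n + 2 < s + t) :
    P.x s * P.x t = P.pp s s t t • (P.x t * P.x s) ∧
    P.x t * P.x s = P.pp t t s s • (P.x s * P.x t) := by
  have key : ∀ i j : Fin n, (i : ℕ) + 1 < j →
      P.X i * P.X j = (P.p i j : F) • (P.X j * P.X i) ∧
      P.X j * P.X i = (P.p j i : F) • (P.X i * P.X j) := by
    intro i j hij
    have h1 : P.X i * P.X j = (P.p i j : F) • (P.X j * P.X i) :=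
      br_eq_zero_iff.1 (P.bracket_X (.far i j hij))
    exact ⟨h1, skew_symm (by rw [← Units.val_mul, P.p_far i j hij, Units.val_one]) h1⟩
  simp only [pp_self]
  have v1 : ∀ i, n < i → i ≤ 2 * n → (letter n i : ℕ) = 2 * n - i := by
    intro i h1 h2
    rw [← letter_congr h2, val_letter (by omega) (by omega)]
    omega
  rcases le_or_gt s n with hsn | hsn
  · have vs := val_letter hs hsn
    rcases le_or_gt t n with htn | htn
    · exact key _ _ (by rw [vs, val_letter (by omega) htn]; omega)
    · have vt := v1 t htn ht
      rcases h with h | h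
      · exact key _ _ (by omega)
      · exact (key _ _ (by omega)).symm
  · have vs := v1 s hsn (by omega)
    have vt := v1 t (by omega) ht
    exact (key _ _ (by omega)).symm

theorem u_mul_x_of_far (P : BParam F n) {k i j : ℕ} (hk : 1 ≤ k) (hki : k ≤ i) (hij : i + 2 ≤ j)
    (hj : j ≤ 2 * n) (h : i + j < 2 * n ∨ 2 * n + 2 < k + j) :
    P.u k i * P.x j = P.pp k i j j • (P.x j * P.u k i) := by
  have := P.u_mul_skew (y := P.x j) (c := fun t => P.pp t t j j) hk hki (by omega) fun t ht => by
    rw [Finset.mem_Icc] at ht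
    exact (P.x_mul_x_of_far (by omega) (by omega) hj (by omega)).1
  simpa [pp] using this

/-- `[x_i, [x_i, x_{i+1}]] = 0` for `i < n`. -/
theorem serre_left (P : BParam F n) {i : ℕ} (hi : 1 ≤ i) (hin : i < n) :
    br (P.pp i i i i * P.pp i i (i + 1) (i + 1)) (P.x i)
      (br (P.pp i i (i + 1) (i + 1)) (P.x i) (P.x (i + 1))) = 0 := by
  have := P.bracket_X (.left (letter n i) (letter n (i + 1))
    (by rw [val_letter hi hin.le, val_letter (by omega) hin]; omega))
  simp only [pp_self]
  rw [← Units.val_mul, ← χ_g, ← χ_g, ← map_mul]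
  exact this

/-- `[[x_i, x_{i+1}], x_{i+1}] = 0` for `i + 1 < n`. -/
theorem serre_right (P : BParam F n) {i : ℕ} (hi : 1 ≤ i) (hin : i + 1 < n) :
    br (P.pp i i (i + 1) (i + 1) * P.pp (i + 1) (i + 1) (i + 1) (i + 1))
      (br (P.pp i i (i + 1) (i + 1)) (P.x i) (P.x (i + 1))) (P.x (i + 1)) = 0 := by
  have := P.bracket_X (.right (letter n i) (letter n (i + 1))
    (by rw [val_letter hi (by omega), val_letter (by omega) hin.le]; omega)
    (by rw [val_letter (by omega) hin.le]; omega))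
  simp only [pp_self]
  rw [← Units.val_mul, ← χ_g, ← χ_g, ← MonoidHom.mul_apply]
  exact this

/-- `[x_i, [x_i, x_{i+1}]] = 0` in the second half of the alphabet, which is traversed backwards. -/
theorem serre_left_reflect (P : BParam F n) {i : ℕ} (hi : n + 1 < i) (hin : i < 2 * n) :
    br (P.pp i i i i * P.pp i i (i + 1) (i + 1)) (P.x i)
      (br (P.pp i i (i + 1) (i + 1)) (P.x i) (P.x (i + 1))) = 0 := by
  have h := P.serre_right (i := 2 * n + 1 - (i + 1)) (by omega) (by omega)
  rw [show 2 * n + 1 - (i + 1) + 1 = 2 * n + 1 - i by omega] at h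
  simp only [x_reflect P (show i ≤ 2 * n by omega), x_reflect P (show i + 1 ≤ 2 * n by omega),
    pp_reflect_left P (show i ≤ 2 * n by omega), pp_reflect_right P (show i ≤ 2 * n by omega),
    pp_reflect_left P (show i + 1 ≤ 2 * n by omega)] at h
  refine br_br_left_of_right (P.pp_ne_zero _ _ _ _) ?_ h
  rw [P.pp_adj (by omega) hin (by omega), P.pp_diag_reflect hi hin.le]

/-- `[[x_i, x_{i+1}], x_{i+1}] = 0` in the second half of the alphabet. -/
theorem serre_right_reflect (P : BParam F n) {i : ℕ} (hi : n < i) (hin : i < 2 * n) :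
    br (P.pp i i (i + 1) (i + 1) * P.pp (i + 1) (i + 1) (i + 1) (i + 1))
      (br (P.pp i i (i + 1) (i + 1)) (P.x i) (P.x (i + 1))) (P.x (i + 1)) = 0 := by
  have h := P.serre_left (i := 2 * n + 1 - (i + 1)) (by omega) (by omega)
  rw [show 2 * n + 1 - (i + 1) + 1 = 2 * n + 1 - i by omega] at h
  simp only [x_reflect P (show i ≤ 2 * n by omega), x_reflect P (show i + 1 ≤ 2 * n by omega),
    pp_reflect_left P (show i + 1 ≤ 2 * n by omega),
    pp_reflect_right P (show i ≤ 2 * n by omega),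
    pp_reflect_right P (show i + 1 ≤ 2 * n by omega)] at h
  refine br_br_right_of_left (P.pp_ne_zero _ _ _ _) ?_ h
  rw [mul_comm, P.pp_adj (by omega) hin (by omega), P.pp_diag_reflect (by omega) hin]

/-- For `i < ψ(j) - 1` the left bracketing of `u[j,i]` can be opened from the left. -/
theorem u_eq_br_x_u (P : BParam F n) {j i : ℕ} (hj : 1 ≤ j) (hji : j < i) (hi : i < 2 * n - j) :
    P.u j i = br (P.pp j j (j + 1) i) (P.x j) (P.u (j + 1) i) := by
  induction i, Nat.succ_le_of_lt hji using Nat.le_induction with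
  | base => rw [u_left P le_rfl (by omega), u_self P (by omega), u_self P (by omega)]
  | succ i hji' ih =>
    rw [u_left P (by omega) (by omega), u_left P hji' (by omega), ih (by omega) (by omega),
      P.pp_split_right j j (show j + 1 ≤ i + 1 by omega) i.le_succ,
      br_br_of_skew (P.x_mul_x_of_far hj (by omega) (by omega) (.inl (by omega))).1,
      P.pp_split_left _ _ j.le_succ (show j ≤ i by omega)]

/-- `[x_k, u[k,i]] = 0` for `k < i < ψ(k) - 1`. -/
theorem br_x_u_eq_zero (P : BParam F n) {k i : ℕ} (hk : 1 ≤ k) (hki : k < i) (hi : i < 2 * n - k) :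
    br (P.pp k k k i) (P.x k) (P.u k i) = 0 := by
  induction i, Nat.succ_le_of_lt hki using Nat.le_induction with
  | base =>
    rw [u_left P le_rfl (by omega), u_self P (by omega),
      P.pp_split_right k k k.le_succ (show k ≤ k.succ from k.le_succ)]
    exact P.serre_left hk (by omega)
  | succ i hki' ih =>
    rw [u_left P (by omega) (by omega), P.pp_split_right k k (show k ≤ i + 1 by omega) i.le_succ,
      br_br_of_skew (P.x_mul_x_of_far hk (by omega) (by omega) (.inl (by omega))).1,
      ih (by omega) (by omega)]
    simp [br]

/-- For `ψ(k) < m` the right bracketing of `u[k,m+1]` can be opened from the right. -/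
theorem u_succ_of_lt (P : BParam F n) {k m : ℕ} (hk : 1 ≤ k) (hkm : k ≤ m) (h : 2 * n + 1 - k < m)
    (hm : m + 1 ≤ 2 * n) :
    P.u k (m + 1) = br (P.pp k m (m + 1) (m + 1)) (P.u k m) (P.x (m + 1)) := by
  induction hkm using Nat.decreasingInduction with
  | self => rw [u_right P m.lt_add_one (by omega), u_self P (by omega), u_self P (by omega)]
  | of_succ k hkm ih =>
    rw [u_right P (by omega) (by omega), ih (by omega) (by omega), u_right P hkm h,
      P.pp_split_right k k (show k + 1 ≤ m + 1 by omega) m.le_succ,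
      br_br_of_skew (P.x_mul_x_of_far hk (by omega) hm (.inr (by omega))).1,
      P.pp_split_left _ _ k.le_succ hkm.le]

/-- `[[[x_t, x_{t+1}], x_{t+2}], x_{t+1}] = 0` when none of the letters passes the middle. -/
theorem u_triple_mul_x (P : BParam F n) (hq4 : P.q ^ 4 ≠ 1) {t : ℕ} (ht : 1 ≤ t)
    (htn : t + 2 ≤ 2 * n) (h : t + 1 < n ∨ n < t) :
    P.u t (t + 2) * P.x (t + 1)
      = P.pp t (t + 2) (t + 1) (t + 1) • (P.x (t + 1) * P.u t (t + 2)) := by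
  have hu : P.u t (t + 2) = br (P.pp t (t + 1) (t + 2) (t + 2))
      (br (P.pp t t (t + 1) (t + 1)) (P.x t) (P.x (t + 1))) (P.x (t + 2)) := by
    rcases h with h | h
    · rw [u_left P (by omega) (by omega), u_left P le_rfl (by omega), u_self P (by omega)]
    · rw [u_succ_of_lt P ht (by omega) (by omega) htn,
        u_succ_of_lt P ht le_rfl (by omega) (by omega), u_self P (by omega)]
  have hs : P.pp (t + 1) (t + 1) (t + 1) (t + 1) = (P.q : F) ^ 2 := by
    rcases h with h | h
    · exact P.pp_diag (by omega) h
    · exact P.pp_diag_reflect (by omega) (by omega)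
  rw [← br_eq_zero_iff, hu, P.pp_split_left _ _ (show t ≤ t + 1 + 1 by omega) (t + 1).le_succ,
    P.pp_split_left _ _ (show t ≤ t + 1 by omega) t.le_succ,
    P.pp_split_left _ _ (show t ≤ t + 1 by omega) t.le_succ]
  refine br_br_mid_eq_zero (P.pp_ne_zero _ _ _ _) (by rw [hs]; exact P.sq_add_one_ne_zero hq4)
    (ba := P.pp (t + 1) (t + 1) t t) ?_ ?_ ?_ ?_
    (P.x_mul_x_of_far ht le_rfl htn (by omega)).1
  · rw [P.pp_adj ht (by omega) (by omega), hs]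
  · rw [P.pp_adj (by omega) (by omega) (by omega), hs]
  · rcases h with h | h
    · exact P.serre_right ht h
    · exact P.serre_right_reflect h (by omega)
  · rcases h with h | h
    · exact P.serre_left (by omega) h
    · exact P.serre_left_reflect (by omega) (by omega)

/-- `u[k,i]` skew commutes with `x_j` for `k < j ≤ i < ψ(j) - 1`, that is, when `x_j` is not the
first letter and neither the mirror image of `x_j` nor the letter before it occurs. -/
theorem u_mul_x_of_mem (P : BParam F n) (hq4 : P.q ^ 4 ≠ 1) {k j i : ℕ} (hk : 1 ≤ k) (hkj : k < j)
    (hji : j ≤ i) (hj : j < n) (hi : i < 2 * n - j) :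
    P.u k i * P.x j = P.pp k i j j • (P.x j * P.u k i) := by
  obtain ⟨t, rfl⟩ : ∃ t, j = t + 1 := ⟨j - 1, by omega⟩
  induction Nat.le_of_lt_succ hkj using Nat.decreasingInduction with
  | self =>
    clear hkj
    induction i, hji using Nat.le_induction with
    | base =>
      rw [← br_eq_zero_iff, u_left P le_rfl (by omega), u_self P (by omega),
        P.pp_split_left _ _ (show t ≤ t + 1 by omega) t.le_succ]
      exact P.serre_right hk hj
    | succ i hti ih =>
      rcases Nat.eq_or_lt_of_le hti with rfl | hlt
      · exact P.u_triple_mul_x hq4 hk (by omega) (.inl hj)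
      · rw [u_left P (by omega) (by omega), br_mul_skew (ih (by omega))
          (P.x_mul_x_of_far (by omega) (by omega) (by omega) (.inl (by omega))).2,
          P.pp_split_left _ _ (show t ≤ i + 1 by omega) i.le_succ]
  | of_succ k hkt ih =>
    rw [u_eq_br_x_u P hk (by omega) (by omega), br_mul_skew
      (P.x_mul_x_of_far hk (by omega) (by omega) (.inl (by omega))).1 (ih (by omega) (by omega)),
      P.pp_split_left (k := k) (m := i) _ _ k.le_succ (by omega)]

/-- In the second half of the alphabet, an inner letter of `u[i,m]` skew commutes with it. -/
theorem x_mul_u_of_mem (P : BParam F n) (hq4 : P.q ^ 4 ≠ 1) {i s m : ℕ} (hi : n < i) (his : i < s)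
    (hsm : s < m) (hm : m ≤ 2 * n) :
    P.x s * P.u i m = P.pp s s i m • (P.u i m * P.x s) := by
  obtain ⟨t, rfl⟩ : ∃ t, s = t + 1 := ⟨s - 1, by omega⟩
  induction Nat.le_of_lt_succ his using Nat.decreasingInduction with
  | self =>
    clear his
    induction m, Nat.succ_le_of_lt hsm using Nat.le_induction with
    | base =>
      refine skew_symm ?_ (P.u_triple_mul_x hq4 (by omega) hm (.inr hi))
      refine (P.pp_mul_pp_eq (e := 0) (by omega) (by omega) hm (by omega) le_rfl (by omega)
        ?_).trans (zpow_zero _)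
      simp (disch := omega) only [epair_far]
      norm_num
    | succ m htm ih =>
      rw [u_succ_of_lt P (by omega) (by omega) (by omega) hm,
        skew_mul_br (ih (by omega) (by omega))
          (P.x_mul_x_of_far (by omega) (by omega) (by omega) (.inr (by omega))).1,
        P.pp_split_right _ _ (show t ≤ m + 1 by omega) m.le_succ]
  | of_succ i hit ih =>
    rw [u_right P (by omega) (by omega), skew_mul_br
      (P.x_mul_x_of_far (by omega) (by omega) (by omega) (.inr (by omega))).2
      (ih (by omega) (by omega)), P.pp_split_right (l := i) (r := m) _ _ i.le_succ (by omega)]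

/-- For `n < m < ψ(k)`, `u[k,m]` is the bracket of its two halves. -/
theorem u_eq_br_u_u_of_lt (P : BParam F n) (hq4 : P.q ^ 4 ≠ 1) {k m : ℕ} (hk : 1 ≤ k) (hkn : k ≤ n)
    (hnm : n < m) (hm : m < 2 * n + 1 - k) :
    P.u k m = br (P.pp k n (n + 1) m) (P.u k n) (P.u (n + 1) m) := by
  induction m, Nat.succ_le_of_lt hnm using Nat.le_induction with
  | base => rw [Nat.succ_eq_add_one, u_left P hkn hm, u_self P (show n + 1 ≤ 2 * n by omega)]
  | succ m hnm' ih =>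
    have h : P.u k n * P.x (m + 1) = P.pp k n (m + 1) (m + 1) • (P.x (m + 1) * P.u k n) := by
      have := P.u_mul_x_of_mem hq4 (j := 2 * n + 1 - (m + 1)) (i := n) hk (by omega) (by omega)
        (by omega) (by omega)
      rwa [x_reflect P (by omega), pp_reflect_right P (by omega)] at this
    rw [u_left P (by omega) hm, ih (by omega) (by omega),
      u_succ_of_lt P (by omega) hnm' (by omega) (by omega),
      P.pp_split_right _ _ (show n + 1 ≤ m + 1 by omega) m.le_succ, br_br_of_skew h,
      P.pp_split_left _ _ (show k ≤ n + 1 by omega) (show n ≤ m by omega)]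

/-- For `k ≤ n` and `ψ(k) < m`, `u[k,m]` is the bracket of its two halves. -/
theorem u_eq_br_u_u_of_gt (P : BParam F n) (hq4 : P.q ^ 4 ≠ 1) {k m : ℕ} (hk : 1 ≤ k) (hkn : k ≤ n)
    (hm : 2 * n + 1 - k < m) (hmn : m ≤ 2 * n) :
    P.u k m = br (P.pp k n (n + 1) m) (P.u k n) (P.u (n + 1) m) := by
  induction hkn using Nat.decreasingInduction with
  | self => rw [u_right P (by omega) hm, u_self P (show n ≤ 2 * n by omega)]
  | of_succ k hkn ih =>
    have h : P.x k * P.u (n + 1) m = P.pp k k (n + 1) m • (P.u (n + 1) m * P.x k) := by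
      have := P.x_mul_u_of_mem hq4 (s := 2 * n + 1 - k) n.lt_succ_self (by omega) hm hmn
      rwa [x_reflect P (by omega), pp_reflect_left P (by omega)] at this
    rw [u_right P (by omega) hm, ih (by omega) (by omega), u_eq_br_x_u P hk hkn (by omega),
      P.pp_split_right _ _ (show k + 1 ≤ n + 1 by omega) (show n ≤ m by omega), br_br_of_skew h,
      P.pp_split_left _ _ k.le_succ hkn.le]

/-- The element `u[k,ψ(k)]` is the bracket of `u[k,ψ(k)-1]` and `x_k` with the scalar deformed by
`q⁻²`. -/
theorem u_mid_eq_br (P : BParam F n) (hq4 : P.q ^ 4 ≠ 1) {k m : ℕ} (hk : 1 ≤ k) (hkn : k ≤ n)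
    (hm : m = 2 * n - k) :
    P.u k (m + 1) = br (((P.q : F) ^ 2)⁻¹ * P.pp k m (m + 1) (m + 1)) (P.u k m) (P.x (m + 1)) := by
  rcases Nat.eq_or_lt_of_le hkn with rfl | hkn
  -- For `k = n` both letters are `x_n`, and both sides are `(1 - q⁻¹) x_n²`.
  · obtain rfl : m = k := by omega
    have hq : (P.q : F) ≠ 0 := Units.ne_zero _
    have hmid := P.u_mid hk le_rfl
    have hr : 2 * m + 1 - m = m + 1 := by omega
    have hx := P.x_reflect (show m ≤ 2 * m by omega)
    have hl := P.pp_reflect_left (show m ≤ 2 * m by omega)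
    have hr' := P.pp_reflect_right (show m ≤ 2 * m by omega)
    rw [hr] at hmid hx
    simp only [hr] at hl hr'
    rw [hmid, hl, hr', P.pp_diag_last, u_self P (show m + 1 ≤ 2 * m by omega),
      u_self P (show m ≤ 2 * m by omega), hx]
    simp only [br, smul_sub, smul_smul]
    match_scalars
    field_simp
    ring
  have hx := br_eq_zero_iff.1 (P.br_x_u_eq_zero hk hkn (by omega))
  rw [← x_reflect P (show k ≤ 2 * n by omega), ← pp_reflect_left P (show k ≤ 2 * n by omega),
    show 2 * n + 1 - k = m + 1 by omega] at hx
  have hmid := P.u_mid hk hkn.le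
  rw [show 2 * n + 1 - k = m + 1 by omega,
    u_succ_of_lt P (show 1 ≤ n + 1 by omega) (by omega) (by omega) (by omega),
    P.pp_split_left _ _ (show n + 1 ≤ m + 1 by omega) m.le_succ] at hmid
  rw [hmid, u_eq_br_u_u_of_lt P (m := m) hq4 hk hkn.le (by omega) (by omega),
    P.pp_split_left _ _ (show k ≤ n + 1 by omega) (show n ≤ m by omega)]
  refine br_mid_formula (Units.ne_zero _) ?_ ?_ hx
  · refine (P.pp_mul_pp_eq (e := 0) (by omega) (by omega) (by omega) (by omega) (by omega)
      (by omega) ?_).trans (zpow_zero _)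
    simp (disch := omega) only [epair_far, epair_zero]
    norm_num
  · refine (P.pp_mul_pp_eq (e := 2) (by omega) (by omega) (by omega) (by omega) (by omega)
      (by omega) ?_).trans (zpow_ofNat _ 2)
    simp (disch := omega) only [epair_far, epair_opp]
    norm_num

/-- The element `u[j+1,ψ(j)]` is the bracket of `u[j+1,ψ(j+1)]` and `x_j`, with the scalar deformed
by `q²`, plus a multiple of `u[j,ψ(j+1)]`. -/
theorem u_mid_succ_eq (P : BParam F n) (hq4 : P.q ^ 4 ≠ 1) {j m : ℕ} (hj : 1 ≤ j) (hjn : j < n)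
    (hm : m = 2 * n - j) :
    P.u (j + 1) (m + 1) =
      br ((P.q : F) ^ 2 * P.pp (j + 1) m (m + 1) (m + 1)) (P.u (j + 1) m) (P.x (m + 1))
        + ((P.q : F) ^ 2 * P.pp (j + 1) m (m + 1) (m + 1)) • P.u j m := by
  have hmid := P.u_mid (show 1 ≤ j + 1 by omega) hjn
  rw [show 2 * n + 1 - (j + 1) = m by omega] at hmid
  have hjx : P.x j = P.x (m + 1) := by
    rw [← x_reflect P (show j ≤ 2 * n by omega), show 2 * n + 1 - j = m + 1 by omega]
  have hjp : ∀ l r, P.pp j j l r = P.pp (m + 1) (m + 1) l r := fun l r => by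
    rw [← pp_reflect_left P (show j ≤ 2 * n by omega), show 2 * n + 1 - j = m + 1 by omega]
  rw [u_eq_br_u_u_of_gt P hq4 (by omega) hjn (by omega) (by omega),
    u_succ_of_lt P (by omega) (show n + 1 ≤ m by omega) (by omega) (by omega), hmid,
    u_eq_br_u_u_of_lt P (m := m) hq4 hj hjn.le (by omega) (by omega),
    u_eq_br_x_u P (i := n) hj hjn (by omega),
    P.pp_split_right _ _ (show n + 1 ≤ m + 1 by omega) m.le_succ,
    P.pp_split_left _ _ (show j + 1 ≤ n + 1 by omega) (show n ≤ m by omega),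
    P.pp_split_left (k := j) _ _ j.le_succ hjn.le, hjx, hjp, hjp]
  refine br_mid_succ_formula (Units.ne_zero _) ?_ ?_ ?_
  · refine (P.pp_mul_pp_eq (e := 2) (by omega) (by omega) (by omega) (by omega) (by omega)
      (by omega) ?_).trans (zpow_ofNat _ 2)
    simp (disch := omega) only [epair_far, epair_opp, epair_zero]
    norm_num
  all_goals
    refine (P.pp_mul_pp_eq (e := -2) (by omega) (by omega) (by omega) (by omega) (by omega)
      (by omega) ?_).trans (by rw [zpow_neg, zpow_ofNat])
    simp (disch := omega) only [epair_far, epair_self, epair_opp]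
    norm_num

/-! ### The coproduct -/

/-- The summand `τ_i (1 - q⁻²) g_k ⋯ g_i u[i+1,m] ⊗ u[k,i]` of the coproduct of `u[k,m]`. -/
noncomputable def coprodTerm (P : BParam F n) (k m i : ℕ) : P.U ⊗[F] P.U :=
  (P.τ i * (1 - (P.q : F)⁻¹ ^ 2)) • ((P.gProd k i * P.u (i + 1) m) ⊗ₜ[F] P.u k i)

/-- The formula for the coproduct of `u[k,m]`. -/
def CoprodFormula (P : BParam F n) (k m : ℕ) : Prop :=
  P.comulHom (P.u k m) = P.u k m ⊗ₜ[F] (1 : P.U) + P.gProd k m ⊗ₜ[F] P.u k m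
    + ∑ i ∈ Finset.Ico k m, P.coprodTerm k m i

/-- What the summand `i` of `Δ(u[k,m])` contributes to `Δ(a x - μ p(a,x) x a)`, where `a = u[k,m]`
and `x = x_{m+1}`. -/
noncomputable def stepTerm (P : BParam F n) (μ : F) (k m i : ℕ) : P.U ⊗[F] P.U :=
  (P.τ i * (1 - (P.q : F)⁻¹ ^ 2)) •
      ((P.gProd k i * br (μ * (P.pp k i (m + 1) (m + 1) * P.pp (m + 1) (m + 1) k i)
          * P.pp (i + 1) m (m + 1) (m + 1)) (P.u (i + 1) m) (P.x (m + 1))) ⊗ₜ[F] P.u k i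
        + P.pp (i + 1) m (m + 1) (m + 1) •
          ((P.gProd k i * P.grp (P.g (letter n (m + 1))) * P.u (i + 1) m) ⊗ₜ[F]
            br (μ * P.pp k i (m + 1) (m + 1)) (P.u k i) (P.x (m + 1))))

/-- The coproduct of `a x - μ p(a,x) x a`, where `a = u[k,m]` satisfies the coproduct formula and
`x = x_{m+1}`. -/
theorem comulHom_br (P : BParam F n) {k m : ℕ} (μ : F) (hk : 1 ≤ k) (hkm : k ≤ m)
    (hm : m + 1 ≤ 2 * n) (ih : P.CoprodFormula k m) :
    P.comulHom (br (μ * P.pp k m (m + 1) (m + 1)) (P.u k m) (P.x (m + 1))) =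
      br (μ * P.pp k m (m + 1) (m + 1)) (P.u k m) (P.x (m + 1)) ⊗ₜ[F] (1 : P.U)
      + P.gProd k (m + 1) ⊗ₜ[F] br (μ * P.pp k m (m + 1) (m + 1)) (P.u k m) (P.x (m + 1))
      + ((1 - μ) * P.pp k m (m + 1) (m + 1)) •
          ((P.grp (P.g (letter n (m + 1))) * P.u k m) ⊗ₜ[F] P.x (m + 1))
      + (1 - μ * (P.pp k m (m + 1) (m + 1) * P.pp (m + 1) (m + 1) k m)) •
          ((P.gProd k m * P.x (m + 1)) ⊗ₜ[F] P.u k m)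
      + ∑ i ∈ Finset.Ico k m, P.stepTerm μ k m i := by
  set x := P.x (m + 1) with hx
  set g := P.grp (P.g (letter n (m + 1))) with hg
  have hΔx : P.comulHom x = x ⊗ₜ[F] (1 : P.U) + g ⊗ₜ[F] x := P.comulHom_X _
  have hΔ : ∀ (c : F) (a : P.U), P.comulHom (br c a x) = br c (P.comulHom a) (P.comulHom x) :=
    fun c a => by
    simp only [br, map_sub, map_mul, map_smul]
  have hpure : ∀ (c : F) (a d : P.U), br c (a ⊗ₜ[F] d) (x ⊗ₜ[F] (1 : P.U) + g ⊗ₜ[F] x) =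
      (a * x) ⊗ₜ[F] d + (a * g) ⊗ₜ[F] (d * x) - c • ((x * a) ⊗ₜ[F] d + (g * a) ⊗ₜ[F] (x * d)) := by
    intro c a d
    simp only [br, mul_add, add_mul, Algebra.TensorProduct.tmul_mul_tmul, one_mul, mul_one]
  have hag : P.u k m * g = P.pp k m (m + 1) (m + 1) • (g * P.u k m) :=
    P.u_mul_grp_g hk hkm (by omega) _
  have hxG : ∀ i, x * P.gProd k i = P.pp (m + 1) (m + 1) k i • (P.gProd k i * x) :=
    P.x_mul_gProd _ _
  have hgG : ∀ i, g * P.gProd k i = P.gProd k i * g := fun i => P.grp_mul_comm _ _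
  rw [hΔ, ih, hΔx, br_add_left, br_add_left, br_sum_left, P.gProd_succ (show k ≤ m + 1 by omega)]
  congr 1
  · rw [hpure, hpure, hxG, hag, hgG, ← hg]
    simp only [br, TensorProduct.sub_tmul, TensorProduct.tmul_sub,
      TensorProduct.tmul_smul, mul_one, one_mul, smul_add, ← TensorProduct.smul_tmul',
      smul_smul]
    module
  · refine Finset.sum_congr rfl fun i hi => ?_
    rw [Finset.mem_Ico] at hi
    have hbg : P.u (i + 1) m * g = P.pp (i + 1) m (m + 1) (m + 1) • (g * P.u (i + 1) m) :=
      P.u_mul_grp_g (by omega) (by omega) (by omega) _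
    rw [coprodTerm, br_smul_left, hpure, stepTerm]
    congr 1
    rw [← mul_assoc x, hxG, ← mul_assoc g, hgG, mul_assoc _ _ g, hbg,
      P.pp_split_left (k := k) (m := m) _ _ (show k ≤ i + 1 by omega) hi.2.le]
    simp only [br, mul_sub, TensorProduct.sub_tmul, TensorProduct.tmul_sub,
      TensorProduct.tmul_smul, smul_mul_assoc, mul_smul_comm, smul_sub, smul_add,
      ← TensorProduct.smul_tmul', smul_smul, mul_assoc]
    module

theorem coprodFormula_self (P : BParam F n) {k : ℕ} (hk : k ≤ 2 * n) : P.CoprodFormula k k := by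
  rw [CoprodFormula, u_self P hk, gProd_self, Finset.Ico_self, Finset.sum_empty, add_zero]
  exact P.comulHom_X _

/-- When `u[k,m+1] = [u[k,m], x_{m+1}]`, the formula for `u[k,m+1]` reduces to an identity between
the sums. -/
theorem coprodFormula_of_br (P : BParam F n) {k m : ℕ} (hk : 1 ≤ k) (hkm : k ≤ m)
    (hm : m + 1 ≤ 2 * n) (ih : P.CoprodFormula k m)
    (hu : P.u k (m + 1) = br (P.pp k m (m + 1) (m + 1)) (P.u k m) (P.x (m + 1)))
    (hs : (1 - P.pp k m (m + 1) (m + 1) * P.pp (m + 1) (m + 1) k m) •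
          ((P.gProd k m * P.x (m + 1)) ⊗ₜ[F] P.u k m)
      + ∑ i ∈ Finset.Ico k m, P.stepTerm 1 k m i
      = ∑ i ∈ Finset.Ico k (m + 1), P.coprodTerm k (m + 1) i) :
    P.CoprodFormula k (m + 1) := by
  have h := P.comulHom_br 1 hk hkm hm ih
  simp only [one_mul, sub_self, zero_mul, zero_smul, add_zero] at h
  rw [CoprodFormula, hu, h, ← hs]
  abel

/-- The generic summand of the induction step: `x_{m+1}` is orthogonal to `u[k,i]`, skew commutes
with it, and extends `u[i+1,m]` to `u[i+1,m+1]`. -/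
theorem coprod_summand_of_skew (P : BParam F n) {k i m : ℕ}
    (h1 : P.pp k i (m + 1) (m + 1) * P.pp (m + 1) (m + 1) k i = 1)
    (h2 : P.u k i * P.x (m + 1) = P.pp k i (m + 1) (m + 1) • (P.x (m + 1) * P.u k i))
    (h3 : P.u (i + 1) (m + 1)
      = br (P.pp (i + 1) m (m + 1) (m + 1)) (P.u (i + 1) m) (P.x (m + 1))) :
    P.stepTerm 1 k m i = P.coprodTerm k (m + 1) i := by
  rw [stepTerm, h1, one_mul, one_mul, one_mul, ← h3, br_eq_zero_iff.2 h2, TensorProduct.tmul_zero,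
    smul_zero, add_zero,
    coprodTerm]

theorem coprodTerm_last (P : BParam F n) {k m : ℕ} (hm : m + 1 ≤ 2 * n) (hmn : m ≠ n) :
    P.coprodTerm k (m + 1) m = (1 - (P.q : F)⁻¹ ^ 2) •
      ((P.gProd k m * P.x (m + 1)) ⊗ₜ[F] P.u k m) := by
  rw [coprodTerm, u_self P hm, τ, if_neg hmn, one_mul]

theorem coprodFormula_succ_of_le (P : BParam F n) {k m : ℕ} (hk : 1 ≤ k) (hkm : k ≤ m)
    (hm : m + 1 ≤ n) (ih : P.CoprodFormula k m) : P.CoprodFormula k (m + 1) := by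
  refine P.coprodFormula_of_br hk hkm (by omega) ih (u_left P hkm (by omega)) ?_
  have hs : P.pp k m (m + 1) (m + 1) * P.pp (m + 1) (m + 1) k m = (P.q : F)⁻¹ ^ 2 := by
    refine (P.pp_mul_pp_eq (e := -2) hk hkm (by omega) (by omega) le_rfl (by omega) ?_).trans ?_
    · simp (disch := omega) only [epair_far, epair_self]
      norm_num
    · rw [zpow_neg, zpow_ofNat, inv_pow]
  rw [Finset.sum_Ico_succ_top hkm, hs, coprodTerm_last P (by omega) (by omega), add_comm]
  congr 1
  refine Finset.sum_congr rfl fun i hi => ?_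
  rw [Finset.mem_Ico] at hi
  exact P.coprod_summand_of_skew (P.pp_mul_pp_of_far hk hi.1 (by omega) (by omega) (by omega))
    (P.u_mul_x_of_far hk hi.1 (by omega) (by omega) (by omega)) (u_left P (by omega) (by omega))

/-- The step from `u[k,n]` to `u[k,n+1]` for `k < n = l + 1`. Here `p(u[k,n],x_n) p(x_n,u[k,n]) =
1`, so `g_k ⋯ g_n ⊗ u[k,n]` and `x_n ⊗ 1` contribute nothing; the summand `i = n` comes from the
summand `i = n - 1` of `Δ(u[k,n])`, whence the factor `τ_n = p(x_n,x_n) = q`. -/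
theorem coprodFormula_middle_letter {l : ℕ} (P : BParam F (l + 1)) (hq4 : P.q ^ 4 ≠ 1) {k : ℕ}
    (hk : 1 ≤ k) (hkl : k ≤ l) (ih : P.CoprodFormula k (l + 1)) :
    P.CoprodFormula k (l + 1 + 1) := by
  have hg : letter (l + 1) (l + 1 + 1) = letter (l + 1) (l + 1) := by
    rw [← letter_congr (show l + 1 ≤ 2 * (l + 1) by omega),
      show 2 * (l + 1) + 1 - (l + 1) = l + 1 + 1 by omega]
  have hx : P.x (l + 1 + 1) = P.x (l + 1) := by rw [x, hg, x]
  have hr : ∀ a b, P.pp a b (l + 1 + 1) (l + 1 + 1) = P.pp a b (l + 1) (l + 1) :=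
    fun a b => by simp [pp, hg]
  refine P.coprodFormula_of_br hk (by omega) (by omega) ih (u_left P (by omega) (by omega)) ?_
  have hs : P.pp k (l + 1) (l + 1 + 1) (l + 1 + 1) * P.pp (l + 1 + 1) (l + 1 + 1) k (l + 1)
      = 1 := by
    refine (P.pp_mul_pp_eq (e := 0) hk (by omega) (by omega) (by omega) le_rfl (by omega)
      ?_).trans (zpow_zero _)
    simp (disch := omega) only [epair_far, epair_zero]
    rfl
  have hsl : P.pp k l (l + 1 + 1) (l + 1 + 1) * P.pp (l + 1 + 1) (l + 1 + 1) k l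
      = ((P.q : F) ^ 2)⁻¹ := by
    refine (P.pp_mul_pp_eq (e := -2) hk (by omega) (by omega) (by omega) le_rfl (by omega)
      ?_).trans (by rw [zpow_neg, zpow_ofNat])
    simp (disch := omega) only [epair_far, epair_opp]
    norm_num
  have hrest : ∀ i ∈ Finset.Ico k l, P.stepTerm 1 k (l + 1) i =
      P.coprodTerm k (l + 1 + 1) i := fun i hi => by
    rw [Finset.mem_Ico] at hi
    exact P.coprod_summand_of_skew (m := l + 1)
      (P.pp_mul_pp_of_far hk hi.1 (by omega) (by omega) (by omega))
      (P.u_mul_x_of_far hk hi.1 (by omega) (by omega) (by omega)) (u_left P (by omega) (by omega))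
  have hul := u_left P hkl (show l + 1 < 2 * (l + 1) + 1 - k by omega)
  rw [← hx, ← hr] at hul
  have hur := P.u_mid_eq_br (k := l + 1) (m := l + 1) hq4 (by omega) le_rfl (by omega)
  rw [hs, sub_self, zero_smul, zero_add, Finset.sum_Ico_succ_top hkl, Finset.sum_congr rfl hrest,
    Finset.sum_Ico_succ_top (show k ≤ l + 1 by omega), Finset.sum_Ico_succ_top hkl,
    add_assoc (Finset.sum _ _)]
  congr 1
  rw [stepTerm, one_mul, one_mul, hsl, ← hul, ← hur, coprodTerm, coprodTerm, hg,
    P.gProd_succ (show k ≤ l + 1 by omega),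
    u_self P (show l + 1 + 1 ≤ 2 * (l + 1) by omega), u_self P (show l + 1 ≤ 2 * (l + 1) by omega),
    hr, pp_diag_last, hx, τ, τ, if_neg (by omega), if_pos rfl]
  module

/-- The step from `u[k,m]` to `u[k,m+1]` for `n < m` and `m + 1 < ψ(k)`. -/
theorem coprodFormula_succ_of_lt (P : BParam F n) (hq4 : P.q ^ 4 ≠ 1) {k m : ℕ} (hk : 1 ≤ k)
    (hnm : n < m) (hm : m + 1 < 2 * n + 1 - k) (ih : P.CoprodFormula k m) :
    P.CoprodFormula k (m + 1) := by
  refine P.coprodFormula_of_br hk (by omega) (by omega) ih (u_left P (by omega) hm) ?_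
  have hs : P.pp k m (m + 1) (m + 1) * P.pp (m + 1) (m + 1) k m = (P.q : F)⁻¹ ^ 2 := by
    refine (P.pp_mul_pp_eq (e := -2) hk (by omega) (by omega) (by omega) le_rfl (by omega)
      ?_).trans ?_
    · simp (disch := omega) only [epair_far, epair_self]
      norm_num
    · rw [zpow_neg, zpow_ofNat, inv_pow]
  rw [Finset.sum_Ico_succ_top (by omega), hs, coprodTerm_last P (by omega) (by omega), add_comm]
  congr 1
  -- The letter `x_{m+1}` equals `x_j` with `j = t + 1`; only the summands `t` and `t + 1` are not
  -- of the generic form, and their deviations cancel.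
  obtain ⟨t, ht⟩ : ∃ t, t + 1 + m = 2 * n := ⟨2 * n - m - 1, by omega⟩
  have hg : letter n (m + 1) = letter n (t + 1) := by
    rw [← letter_congr (show t + 1 ≤ 2 * n by omega),
      show 2 * n + 1 - (t + 1) = m + 1 by omega]
  have hx : P.x (m + 1) = P.x (t + 1) := by rw [x, hg, x]
  have hr : ∀ a b, P.pp a b (m + 1) (m + 1) = P.pp a b (t + 1) (t + 1) :=
    fun a b => by simp [pp, hg]
  have hl : ∀ a b, P.pp (m + 1) (m + 1) a b = P.pp (t + 1) (t + 1) a b :=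
    fun a b => by simp [pp, hg]
  set R := (1 - (P.q : F)⁻¹ ^ 2) • P.pp (t + 1) m (m + 1) (m + 1) •
    ((P.gProd k (t + 1) * P.u (t + 1) m) ⊗ₜ[F] P.u k (t + 1)) with hR
  trans ∑ i ∈ Finset.Ico k m, (P.coprodTerm k (m + 1) i + (if i = t then R else 0)
    - (if i = t + 1 then R else 0))
  · refine Finset.sum_congr rfl fun i hi => ?_
    rw [Finset.mem_Ico] at hi
    rcases lt_trichotomy i t with hit | rfl | hit
    · rw [if_neg (by omega), if_neg (by omega), add_zero, sub_zero]
      exact P.coprod_summand_of_skew (P.pp_mul_pp_of_far hk hi.1 (by omega) (by omega) (by omega))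
        (P.u_mul_x_of_far hk hi.1 (by omega) (by omega) (by omega))
        (u_left P (by omega) (by omega))
    · have hsi : P.pp k i (m + 1) (m + 1) * P.pp (m + 1) (m + 1) k i = ((P.q : F) ^ 2)⁻¹ := by
        refine (P.pp_mul_pp_eq (e := -2) hk (by omega) (by omega) (by omega) le_rfl (by omega)
          ?_).trans (by rw [zpow_neg, zpow_ofNat])
        simp (disch := omega) only [epair_far, epair_opp]
        norm_num
      have hul := u_left P hi.1 (show i + 1 < 2 * n + 1 - k by omega)
      rw [← hx, ← hr] at hul
      rw [if_pos rfl, if_neg (by omega), sub_zero, stepTerm, one_mul, one_mul, hsi, ← hul,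
        ← P.u_mid_eq_br hq4 (by omega) (by omega) (by omega), hg,
        ← P.gProd_succ (show k ≤ i + 1 by omega), coprodTerm, τ, if_neg (by omega), one_mul,
        smul_add, hR]
    rcases Nat.eq_or_lt_of_le (Nat.succ_le_of_lt hit) with rfl | hit'
    · have hsi : P.pp k t.succ (m + 1) (m + 1) * P.pp (m + 1) (m + 1) k t.succ = (P.q : F) ^ 2 := by
        refine (P.pp_mul_pp_eq (e := 2) hk (by omega) (by omega) (by omega) le_rfl (by omega)
          ?_).trans (zpow_ofNat _ 2)
        simp (disch := omega) only [epair_far, epair_opp]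
        norm_num
      have h0 : P.u k t.succ * P.x (m + 1)
          = P.pp k t.succ (m + 1) (m + 1) • (P.x (m + 1) * P.u k t.succ) := by
        rw [hx, hr]
        exact P.u_mul_x_of_mem hq4 hk (by omega) le_rfl (by omega) (by omega)
      rw [if_neg (by omega), if_pos rfl, add_zero, stepTerm, one_mul, one_mul, hsi,
        br_eq_zero_iff.2 h0,
        TensorProduct.tmul_zero, smul_zero, add_zero, coprodTerm,
        P.u_mid_succ_eq hq4 (j := t.succ) (m := m) (by omega) (by omega) (by omega), τ,
        if_neg (by omega), one_mul, hR,
        P.pp_split_left (k := t + 1) (m := m) _ _ (t + 1).le_succ (by omega), hr (t + 1) (t + 1),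
        P.pp_diag (by omega) (by omega), mul_add, TensorProduct.add_tmul, mul_smul_comm,
        ← TensorProduct.smul_tmul', smul_add, add_sub_cancel_right]
    · have h2 : P.u k i * P.x (m + 1) = P.pp k i (m + 1) (m + 1) • (P.x (m + 1) * P.u k i) := by
        rw [hx, hr]
        exact P.u_mul_x_of_mem hq4 hk (by omega) hit (by omega) (by omega)
      rw [if_neg (by omega), if_neg (by omega), add_zero, sub_zero]
      refine P.coprod_summand_of_skew ?_ h2 (u_succ_of_lt P (by omega) hi.2 (by omega) (by omega))
      refine (P.pp_mul_pp_eq (e := 0) hk (by omega) (by omega) (by omega) le_rfl (by omega)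
        ?_).trans (zpow_zero _)
      simp (disch := omega) only [epair_far]
      norm_num
  · rw [Finset.sum_sub_distrib, Finset.sum_add_distrib, Finset.sum_ite_eq', Finset.sum_ite_eq',
      if_pos (Finset.mem_Ico.2 (by omega)), if_pos (Finset.mem_Ico.2 (by omega)),
      add_sub_cancel_right]

/-- The step to `u[k,ψ(k)]`.  The deformed bracket leaves a multiple of `g_k u[k,m] ⊗ x_k`, which
cancels against the second term of `u[k+1,ψ(k)]` in the summand `i = k`. -/
theorem coprodFormula_mid (P : BParam F n) (hq4 : P.q ^ 4 ≠ 1) {k m : ℕ} (hk : 1 ≤ k) (hkn : k ≤ n)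
    (hm : m = 2 * n - k) (ih : P.CoprodFormula k m) : P.CoprodFormula k (m + 1) := by
  have hq : (P.q : F) ≠ 0 := Units.ne_zero _
  have hg : letter n (m + 1) = letter n k := by
    rw [← letter_congr (show k ≤ 2 * n by omega), show 2 * n + 1 - k = m + 1 by omega]
  have hx : P.x (m + 1) = P.x k := by rw [x, hg, x]
  have hl : ∀ l r, P.pp (m + 1) (m + 1) l r = P.pp k k l r := fun l r => by simp [pp, hg]
  have hr : ∀ l r, P.pp l r (m + 1) (m + 1) = P.pp l r k k := fun l r => by simp [pp, hg]
  have h := P.comulHom_br ((P.q : F) ^ 2)⁻¹ hk (by omega) (by omega) ih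
  rw [← P.u_mid_eq_br hq4 hk hkn hm] at h
  rw [CoprodFormula, h, add_assoc, add_assoc]
  congr 1
  rw [Finset.sum_Ico_succ_top (by omega)]
  clear h
  rcases Nat.eq_or_lt_of_le hkn with rfl | hkn
  · obtain rfl : m = k := by omega
    rw [Finset.Ico_self, Finset.sum_empty, Finset.sum_empty, add_zero, zero_add, hr, hl,
      pp_diag_last, coprodTerm, u_self P (show m + 1 ≤ 2 * m by omega),
      u_self P (show m ≤ 2 * m by omega), hx, hg, gProd_self, τ, if_pos rfl, ← add_smul]
    congr 1
    field_simp
    ring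
  -- Now `k < n`; all summands except the first are generic.
  have hs : P.pp k m (m + 1) (m + 1) * P.pp (m + 1) (m + 1) k m = 1 := by
    refine (P.pp_mul_pp_eq (e := 0) hk (by omega) (by omega) (by omega) le_rfl (by omega)
      ?_).trans (zpow_zero _)
    simp (disch := omega) only [epair_far, epair_self, epair_opp]
    norm_num
  have hrest : ∀ i ∈ Finset.Ico (k + 1) m, P.stepTerm ((P.q : F) ^ 2)⁻¹ k m i
      = P.coprodTerm k (m + 1) i := by
    intro i hi
    rw [Finset.mem_Ico] at hi
    have hsi : P.pp k i (m + 1) (m + 1) * P.pp (m + 1) (m + 1) k i = (P.q : F) ^ 2 := by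
      refine (P.pp_mul_pp_eq (e := 2) hk (by omega) (by omega) (by omega) le_rfl (by omega)
        ?_).trans (zpow_ofNat _ 2)
      simp (disch := omega) only [epair_far, epair_opp]
      norm_num
    have h0 : br (((P.q : F) ^ 2)⁻¹ * P.pp k i (m + 1) (m + 1)) (P.u k i) (P.x (m + 1)) = 0 := by
      rw [br_eq_zero_iff]
      refine skew_symm (c := P.pp (m + 1) (m + 1) k i) ?_ ?_
      · rw [mul_left_comm, mul_comm (P.pp _ _ _ _), hsi, inv_mul_cancel₀ (pow_ne_zero _ hq)]
      · rw [hx, hl]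
        exact br_eq_zero_iff.1 (P.br_x_u_eq_zero hk (by omega) (by omega))
    rw [stepTerm, h0, hsi, inv_mul_cancel₀ (pow_ne_zero _ hq), one_mul, coprodTerm,
      TensorProduct.tmul_zero,
      smul_zero, add_zero, u_succ_of_lt P (m := m) (by omega) (by omega) (by omega) (by omega)]
  rw [Finset.sum_eq_sum_Ico_succ_bot (show k < m by omega), Finset.sum_congr rfl hrest,
    Finset.sum_eq_sum_Ico_succ_bot (show k < m by omega), hs,
    coprodTerm_last P (by omega) (by omega)]
  have hlast := P.u_mid_succ_eq hq4 hk hkn hm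
  have h0 : br (((P.q : F) ^ 2)⁻¹ * P.pp k k (m + 1) (m + 1)) (P.x k) (P.x (m + 1)) = 0 := by
    rw [hr, hx, pp_diag P hk hkn, inv_mul_cancel₀ (pow_ne_zero _ hq), br, one_smul, sub_self]
  have hc : ((P.q : F) ^ 2)⁻¹ * (P.pp k k (m + 1) (m + 1) * P.pp (m + 1) (m + 1) k k)
      = (P.q : F) ^ 2 := by
    rw [hr, hl, pp_diag P hk hkn]
    field_simp
  rw [stepTerm, u_self P (show k ≤ 2 * n by omega), h0, hc, coprodTerm,
    u_self P (show k ≤ 2 * n by omega), hlast,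
    P.pp_split_left (k := k) (m := m) _ _ k.le_succ (by omega), hr k k, pp_diag P hk hkn,
    gProd_self, hg, hx, TensorProduct.tmul_zero, smul_zero, add_zero, mul_add,
    TensorProduct.add_tmul, mul_smul_comm, ← TensorProduct.smul_tmul', τ, if_neg (by omega),
    show (P.q : F)⁻¹ ^ 2 = ((P.q : F) ^ 2)⁻¹ from inv_pow _ _]
  simp only [smul_add, smul_smul, mul_one]
  module

/-- The step from `u[j+1,ψ(j+1)]` to `u[j+1,ψ(j)]`, which needs the coproduct of
`u[j,ψ(j+1)]` too. -/
theorem coprodFormula_mid_succ (P : BParam F n) (hq4 : P.q ^ 4 ≠ 1) {j m : ℕ} (hj : 1 ≤ j)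
    (hjn : j < n) (hm : m = 2 * n - j) (ih : P.CoprodFormula (j + 1) m)
    (ih' : P.CoprodFormula j m) : P.CoprodFormula (j + 1) (m + 1) := by
  have hq : (P.q : F) ≠ 0 := Units.ne_zero _
  have hg : letter n (m + 1) = letter n j := by
    rw [← letter_congr (show j ≤ 2 * n by omega), show 2 * n + 1 - j = m + 1 by omega]
  have hx : P.x (m + 1) = P.x j := by rw [x, hg, x]
  have hl : ∀ l r, P.pp (m + 1) (m + 1) l r = P.pp j j l r := fun l r => by simp [pp, hg]
  -- The group-like factors of `Δ(u[j,m])` match those in `comulHom_br`, as `x_{m+1} = x_j`.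
  have hgP : ∀ i, j ≤ i → P.gProd j i = P.gProd (j + 1) i * P.grp (P.g (letter n (m + 1))) := by
    intro i hi
    rw [gProd, prod_Icc_split _ j.le_succ hi, Finset.Icc_self, Finset.prod_singleton, mul_comm,
      grp_mul, hg, gProd]
  have h := P.comulHom_br ((P.q : F) ^ 2) (show 1 ≤ j + 1 by omega) (by omega) (by omega) ih
  have hs : P.pp (j + 1) m (m + 1) (m + 1) * P.pp (m + 1) (m + 1) (j + 1) m
      = ((P.q : F) ^ 4)⁻¹ := by
    refine (P.pp_mul_pp_eq (e := -4) (by omega) (by omega) (by omega) (by omega) le_rfl (by omega)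
      ?_).trans (by rw [zpow_neg, zpow_ofNat])
    simp (disch := omega) only [epair_far, epair_self, epair_opp]
    norm_num
  have hrest : ∀ i ∈ Finset.Ico (j + 1) m, P.stepTerm ((P.q : F) ^ 2) (j + 1) m i
      = P.coprodTerm (j + 1) (m + 1) i
        - ((P.q : F) ^ 2 * P.pp (j + 1) m (m + 1) (m + 1)) • P.coprodTerm j m i := by
    intro i hi
    rw [Finset.mem_Ico] at hi
    have hsi : P.pp (j + 1) i (m + 1) (m + 1) * P.pp (m + 1) (m + 1) (j + 1) i
        = ((P.q : F) ^ 2)⁻¹ := by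
      refine (P.pp_mul_pp_eq (e := -2) (by omega) (by omega) (by omega) (by omega) le_rfl
        (by omega) ?_).trans (by rw [zpow_neg, zpow_ofNat])
      simp (disch := omega) only [epair_far, epair_opp]
      norm_num
    have h0 : br ((P.q : F) ^ 2 * P.pp (j + 1) i (m + 1) (m + 1)) (P.u (j + 1) i) (P.x (m + 1))
        = (-((P.q : F) ^ 2 * P.pp (j + 1) i (m + 1) (m + 1))) • P.u j i := by
      rw [u_eq_br_x_u P (i := i) hj (by omega) (by omega), ← hx, ← hl, br, br, smul_sub, smul_smul,
        neg_mul, mul_assoc, hsi, mul_inv_cancel₀ (pow_ne_zero _ hq)]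
      module
    rw [stepTerm, h0, hsi, mul_inv_cancel₀ (pow_ne_zero _ hq), one_mul, coprodTerm, coprodTerm,
      u_succ_of_lt P (k := i + 1) (m := m) (by omega) (by omega) (by omega) (by omega),
      hgP i (by omega),
      P.pp_split_left (k := j + 1) (m := m) _ _ (show j + 1 ≤ i + 1 by omega) hi.2.le,
      TensorProduct.tmul_smul]
    module
  rw [Finset.sum_congr rfl hrest, Finset.sum_sub_distrib, ← Finset.smul_sum, hs] at h
  have hext := ih'
  rw [CoprodFormula] at hext
  rw [Finset.sum_eq_sum_Ico_succ_bot (show j < m by omega)] at hext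
  have hfirst : P.coprodTerm j m j = (1 - (P.q : F)⁻¹ ^ 2) •
      ((P.grp (P.g (letter n (m + 1))) * P.u (j + 1) m) ⊗ₜ[F] P.x (m + 1)) := by
    rw [coprodTerm, gProd_self, u_self P (show j ≤ 2 * n by omega), hx, hg, τ, if_neg (by omega),
      one_mul]
  rw [CoprodFormula, P.u_mid_succ_eq hq4 hj hjn hm, map_add, map_smul, h, hext, hfirst,
    Finset.sum_Ico_succ_top (by omega), coprodTerm_last P (by omega) (by omega), hgP m (by omega),
    P.gProd_succ (show j + 1 ≤ m + 1 by omega)]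
  simp only [TensorProduct.add_tmul, TensorProduct.tmul_add, TensorProduct.tmul_smul, smul_add,
    ← TensorProduct.smul_tmul', smul_smul]
  match_scalars <;> field_simp <;> ring

theorem coprodFormula_succ_of_gt (P : BParam F n) {k m : ℕ} (hk : 1 ≤ k) (hkm : k ≤ m)
    (hm : m + 1 ≤ 2 * n) (h : 2 * n + 1 - k < m) (ih : P.CoprodFormula k m) :
    P.CoprodFormula k (m + 1) := by
  refine P.coprodFormula_of_br hk hkm hm ih (u_succ_of_lt P hk hkm h hm) ?_
  have hs : P.pp k m (m + 1) (m + 1) * P.pp (m + 1) (m + 1) k m = (P.q : F)⁻¹ ^ 2 := by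
    refine (P.pp_mul_pp_eq (e := -2) hk hkm (by omega) (by omega) le_rfl hm ?_).trans ?_
    · simp (disch := omega) only [epair_far, epair_self]
      norm_num
    · rw [zpow_neg, zpow_ofNat, inv_pow]
  rw [Finset.sum_Ico_succ_top hkm, hs, coprodTerm_last P hm (by omega), add_comm]
  congr 1
  refine Finset.sum_congr rfl fun i hi => ?_
  rw [Finset.mem_Ico] at hi
  exact P.coprod_summand_of_skew (P.pp_mul_pp_of_far hk hi.1 (by omega) hm (by omega))
    (P.u_mul_x_of_far hk hi.1 (by omega) hm (by omega))
    (u_succ_of_lt P (by omega) (by omega) (by omega) hm)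

theorem coprodFormula (P : BParam F n) (hq4 : P.q ^ 4 ≠ 1) {k m : ℕ} (hk : 1 ≤ k) (hkm : k ≤ m)
    (hm : m ≤ 2 * n) : P.CoprodFormula k m := by
  induction m generalizing k with
  | zero => omega
  | succ m ih =>
    rcases Nat.eq_or_lt_of_le hkm with rfl | hkm
    · exact P.coprodFormula_self hm
    have hkm := Nat.le_of_lt_succ hkm
    have ihk := ih hk hkm (by omega)
    rcases lt_trichotomy (m + 1) (2 * n + 1 - k) with h | h | h
    · rcases lt_trichotomy m n with hmn | rfl | hmn
      · exact P.coprodFormula_succ_of_le hk hkm hmn ihk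
      · obtain ⟨l, rfl⟩ : ∃ l, m = l + 1 := ⟨m - 1, by omega⟩
        exact P.coprodFormula_middle_letter hq4 hk (by omega) ihk
      · exact P.coprodFormula_succ_of_lt hq4 hk hmn h ihk
    · exact P.coprodFormula_mid hq4 hk (by omega) (by omega) ihk
    · rcases Nat.eq_or_lt_of_le (Nat.le_of_lt_succ h) with h | h
      · obtain ⟨j, rfl⟩ : ∃ j, k = j + 1 := ⟨k - 1, by omega⟩
        exact P.coprodFormula_mid_succ hq4 (by omega) (by omega) (by omega) ihk
          (ih (by omega) (by omega) (by omega))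
      · exact P.coprodFormula_succ_of_gt hk hkm hm h ihk

end BParam

theorem mainTheorem3 {F : Type*} [Field F] (n : ℕ) [NeZero n] (P : BParam F n)
    (hq3 : P.q ^ 3 ≠ 1) (hq4 : P.q ^ 4 ≠ 1) (k m : ℕ) (hk : 1 ≤ k) (hkm : k ≤ m)
    (hm : m ≤ 2 * n) :
    Coalgebra.comul (R := F) (P.u k m) =
      P.u k m ⊗ₜ[F] (1 : P.U) + P.gProd k m ⊗ₜ[F] P.u k m
        + ∑ i ∈ Finset.Ico k m, (P.τ i * (1 - (P.q : F)⁻¹ ^ 2)) •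
            ((P.gProd k i * P.u (i + 1) m) ⊗ₜ[F] P.u k i) :=
  P.coprodFormula hq4 hk hkm hm
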